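/- Let $n\ge 3$, $G_0=\mathrm{GL}^+(2,\mathbb R)\times\mathrm{SO}(n)$, $\tilde G_0=\mathrm{GL}^+(2,\mathbb R)\times\mathrm{Spin}(n)$ and $G_0^c=\mathrm{GL}^+(2,\mathbb R)\times\mathrm{Spin}^c(n)$, where $\mathrm{Spin}^c(n)=(\mathrm U(1)\times\mathrm{Spin}(n))/\{\pm(1,1)\}$ has elements $\langle z,a\rangle$. Let $\rho_n^c\langle z,a\rangle=\rho_n(a)\in\mathrm{SO}(n)$, with $\rho_n:\mathrm{Spin}(n)\to\mathrm{SO}(n)$ the double covering, and $\varsigma_n\langle z,a\rangle=z^2\in\mathrm U(1)$, and regard $\tilde G_0$ as the subgroup of all $(A,\langle 1,a\rangle)$ of $G_0^c$. Let $\mathfrak g_-=\mathfrak g_{-2}\oplus\mathfrak g_{-1}$ be the Heisenberg algebra with $\mathfrak g_{-1}=M_{n\times 2}(\mathbb R)$, $\mathfrak g_{-2}$ the skew-symmetric $2\times2$ matrices and $[X,Y]=Y^TX-X^TY$; $(A,B)\in G_0$ acts on $\mathfrak g_{-1}$ by $X\mapsto BXA^{-1}$. Setting. Let $(\mathcal G_0,M,p_0,\theta)$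 be a PCS-structure of Grassmannian type on a manifold $M$ of dimension $2n$, that is, a $G_0$-structure with $\mathfrak g_{-1}$-valued soldering form $\theta$ such that the line bundle $\ell\subset\Lambda^2T^*M$ spanned, in the frames of $\mathcal G_0$, by the bracket $\mathfrak g_{-1}\times\mathfrak g_{-1}\to\mathfrak g_{-2}\cong\mathbb R$ has nowhere vanishing closed local sections. Let $p_0^c:\mathcal G_0^c\to M$ be a principal $G_0^c$-bundle with a map $\mathcal G_0^c\to\mathcal G_0$ over $M$ that is equivariant for $\mathrm{id}\times\rho_n^c$, let $q:M^\sharp=\mathcal G_0^c\times_{\varsigma_n}\mathrm U(1)\to M$ be its determinant circle bundle, and let $i\alpha$ be a compatible principal connection on it: $\alpha$ is an invariant $1$-form with $\alpha(\partial_t)=1$, where $\partial_t$ is the fundamental vector field of $i\in\mathfrak u(1)$, and $d\alpha=q^*\Omega$ for a closed section $\Omega$ of $\ell$. Let $M^\sharp$ carry the Lie contact structure of type $(\tilde G,\tilde P)$, where $\tilde G=\mathrm{Spin}_o(2,n+2)$ and $\tilde P$ is its contact parabolic subgroup with Levi factor $\tilde G_0$, with the following properties: its contact distribution is $H=\ker\alpha$,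 its principal $\tilde G_0$-bundle is $\mathcal G_0^c\to M^\sharp$, $u\mapsto[u,1]$, the Reeb field $\xi$ of $\alpha$ is a transversal infinitesimal symmetry, and $\mathcal G_0^c\to\mathcal G_0$ induces a PCS-quotient $q_0:\mathcal G_0^c/\{\pm1\}\to\mathcal G_0$ by $\xi$ (that is, $q_0$ is surjective with connected fibres, the kernel of $Tq_0$ is spanned by the lift of $\xi$, and $q_0^*\theta$ restricts on the vectors that project into $H$ to the tautological $\mathfrak g_{-1}$-valued partial form). For a $\tilde G_0$-module $\mathbb V$, the Lie derivative $\mathcal L_\xi$ on sections of $\mathcal G_0^c\times_{\tilde G_0}\mathbb V$ is the derivative of the corresponding equivariant functions on $\mathcal G_0^c$ along the lift of $\xi$. Let $(\mathbb V,\varrho)$ and $(\mathbb W,\vartheta)$ be finite dimensional complex representations of $\tilde G_0$ on which $-1\in\mathrm{Spin}(n)$ acts as $-\mathrm{id}$, and extend them to $G_0^c$ by $\varrho^c(A,\langle z,a\rangle)=z\,\varrho(A,a)$, and likewise $\vartheta^c$. Put $V=\mathcal G_0^c\times_{G_0^c}\mathbb V\to M$ and $V^\sharp=\mathcal G_0^c\times_{\tilde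 G_0}\mathbb V\to M^\sharp$, and likewise $W$, $W^\sharp$. (1) There is a canonical complex-linear isomorphism $$\varphi_{\mathbb V}:\Gamma(V)\to\{v\in\Gamma(V^\sharp):\ \mathcal L_\xi v=-\tfrac i2\,v\},$$ which sends a section $s$ with $s(p_0^c(u))=[u,v]$ to the section with value $[u,v]$ at the point $[u,1]\in M^\sharp$; the same holds for $\mathbb W$. (Equivalently, the equation is $\mathcal L_{2\xi}v=-iv$, and $2\xi$ is the vector field on $M^\sharp$ induced by the generator $i$ of the centre $\mathrm U(1)$ of $\mathrm{Spin}^c(n)$.) (2) If $D^\sharp:\Gamma(V^\sharp)\to\Gamma(W^\sharp)$ is a complex-linear differential operator that is natural for Lie contact structures of type $(\tilde G,\tilde P)$ (a member of a family of such operators, one for each Lie contact structure, compatible with all morphisms of Lie contact structures that cover local diffeomorphisms), then there is a unique complex-linear differential operator $D:\Gamma(V)\to\Gamma(W)$ with $\varphi_{\mathbb W}\circ D=D^\sharp\circ\varphi_{\mathbb V}$. -/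

import Mathlib

open scoped Manifold ContDiff MatrixGroups
universe u

namespace LieContact

/-- The quadratic form `v ↦ v₁² + ⋯ + vₙ²`. -/
noncomputable def euclForm (n : ℕ) : QuadraticForm ℝ (Fin n → ℝ) :=
  QuadraticMap.weightedSumSquares ℝ (fun _ : Fin n => (1 : ℝ))

abbrev Cl (n : ℕ) : Type := CliffordAlgebra (euclForm n)

/-- The group `Spin(n)`. -/
abbrev Spin (n : ℕ) : Type := spinGroup (euclForm n)

abbrev SO (n : ℕ) : Type := Matrix.specialOrthogonalGroup (Fin n) ℝ

/-- The inclusion of `ℝⁿ` in its Clifford algebra. -/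
noncomputable abbrev vec (n : ℕ) : (Fin n → ℝ) →ₗ[ℝ] Cl n := CliffordAlgebra.ι (euclForm n)

theorem euclForm_apply (n : ℕ) (v : Fin n → ℝ) : euclForm n v = v ⬝ᵥ v := by
  simp [euclForm, QuadraticMap.weightedSumSquares_apply, dotProduct]

theorem vec_injective (n : ℕ) : Function.Injective (vec n) := by
  intro v w h
  have key : ∀ x : Fin n → ℝ,
      CliffordAlgebra.equivExterior (euclForm n) (vec n x) = ExteriorAlgebra.ι ℝ x := fun x =>
    CliffordAlgebra.changeForm_ι CliffordAlgebra.changeForm.associated_neg_proof x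
  have h2 := congrArg (CliffordAlgebra.equivExterior (euclForm n)) h
  rw [key, key] at h2
  exact (ExteriorAlgebra.ι_inj ℝ v w).1 h2

theorem polar_euclForm (n : ℕ) (v w : Fin n → ℝ) :
    QuadraticMap.polar (euclForm n) v w = 2 * (v ⬝ᵥ w) := by
  simp only [QuadraticMap.polar, euclForm_apply, add_dotProduct, dotProduct_add,
    dotProduct_comm w v]
  ring

/-- `A` is the orthogonal transformation that the element `x` induces on vectors by twisted
conjugation, with determinant `1` or `-1` according to the parity of `x`. -/
def Induces {n : ℕ} (x : Cl n) (A : Matrix (Fin n) (Fin n) ℝ) : Prop :=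
  (∀ v, CliffordAlgebra.involute x * vec n v = vec n (A.mulVec v) * x) ∧
    A * A.transpose = 1 ∧
    ((CliffordAlgebra.involute x = x ∧ A.det = 1) ∨
      (CliffordAlgebra.involute x = -x ∧ A.det = -1))

theorem exists_induces {n : ℕ} (x : (Cl n)ˣ) (hx : x ∈ lipschitzGroup (euclForm n)) :
    ∃ A, Induces (x : Cl n) A := by
  unfold lipschitzGroup at hx
  induction hx using Subgroup.closure_induction with
  | mem x hx =>
    obtain ⟨a, ha⟩ := hx
    have ha0 : a ⬝ᵥ a ≠ 0 := by
      intro h0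
      have h1 := CliffordAlgebra.ι_sq_scalar (euclForm n) a
      rw [euclForm_apply, h0, map_zero, ha] at h1
      have : (x : Cl n) = 0 := by
        have := congrArg (fun y => (↑x⁻¹ : Cl n) * y) h1
        simpa only [Units.inv_mul_cancel_left, mul_zero] using this
      exact x.ne_zero this
    refine ⟨1 - (2 / (a ⬝ᵥ a)) • Matrix.vecMulVec a a, ?_, ?_, Or.inr ⟨?_, ?_⟩⟩
    · intro v
      rw [← ha, CliffordAlgebra.involute_ι]
      have e1 : (1 - (2 / (a ⬝ᵥ a)) • Matrix.vecMulVec a a).mulVec v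
          = v - (2 * (a ⬝ᵥ v) / (a ⬝ᵥ a)) • a := by
        rw [Matrix.sub_mulVec, Matrix.one_mulVec, Matrix.smul_mulVec, Matrix.vecMulVec_mulVec]
        ext i
        simp
        ring
      rw [e1, map_sub, map_smul, sub_mul, smul_mul_assoc, CliffordAlgebra.ι_sq_scalar,
        euclForm_apply, neg_mul, CliffordAlgebra.ι_mul_ι_comm, polar_euclForm,
        Algebra.smul_def, ← (algebraMap ℝ (Cl n)).map_mul, div_mul_cancel₀ _ ha0, neg_sub]
    · have e2 : Matrix.vecMulVec a a * Matrix.vecMulVec a a = (a ⬝ᵥ a) • Matrix.vecMulVec a a := by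
        rw [Matrix.vecMulVec_mul_vecMulVec]
        ext i j
        simp [Matrix.vecMulVec_apply]
        try ring
      rw [Matrix.transpose_sub, Matrix.transpose_smul, Matrix.transpose_vecMulVec,
        Matrix.transpose_one, sub_mul, one_mul, mul_sub, mul_one, smul_mul_smul_comm, e2, smul_smul]
      have e3 : 2 / (a ⬝ᵥ a) * (2 / (a ⬝ᵥ a)) * (a ⬝ᵥ a) = 2 / (a ⬝ᵥ a) + 2 / (a ⬝ᵥ a) := by
        field_simp
        norm_num
      rw [e3, add_smul]
      abel
    · rw [← ha, CliffordAlgebra.involute_ι]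
    · have e4 : (1 : Matrix (Fin n) (Fin n) ℝ) - (2 / (a ⬝ᵥ a)) • Matrix.vecMulVec a a
          = 1 + Matrix.replicateCol Unit (-(2 / (a ⬝ᵥ a)) • a) * Matrix.replicateRow Unit a := by
        rw [← Matrix.vecMulVec_eq, Matrix.smul_vecMulVec, neg_smul, sub_eq_add_neg]
      rw [e4, Matrix.det_one_add_replicateCol_mul_replicateRow, dotProduct_smul, smul_eq_mul,
        neg_mul, div_mul_cancel₀ _ ha0]
      norm_num
  | one => exact ⟨1, by simp, by simp, Or.inl (by simp)⟩
  | mul x y _ _ hx hy =>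
    obtain ⟨A, hA, hA2, hA3⟩ := hx
    obtain ⟨B, hB, hB2, hB3⟩ := hy
    refine ⟨A * B, ?_, ?_, ?_⟩
    · intro v
      rw [Units.val_mul, map_mul, mul_assoc, hB, ← mul_assoc, hA, Matrix.mulVec_mulVec, mul_assoc]
    · rw [Matrix.transpose_mul, mul_assoc, ← mul_assoc B, hB2, one_mul, hA2]
    · rw [Units.val_mul, map_mul, Matrix.det_mul]
      rcases hA3 with ⟨h1, h2⟩ | ⟨h1, h2⟩ <;> rcases hB3 with ⟨h3, h4⟩ | ⟨h3, h4⟩ <;>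
        simp [h1, h2, h3, h4]
  | inv x _ hx =>
    obtain ⟨A, hA, hA2, hA3⟩ := hx
    have hA2' : A.transpose * A = 1 := mul_eq_one_comm.1 hA2
    have hi : CliffordAlgebra.involute (x : Cl n) * CliffordAlgebra.involute (↑x⁻¹ : Cl n) = 1 := by
      rw [← map_mul]; simp
    have hi' : CliffordAlgebra.involute (↑x⁻¹ : Cl n) * CliffordAlgebra.involute (x : Cl n) = 1 := by
      rw [← map_mul]; simp
    refine ⟨A.transpose, ?_, ?_, ?_⟩
    · intro v
      have h := hA (A.transpose.mulVec v)
      rw [Matrix.mulVec_mulVec, hA2, Matrix.one_mulVec] at h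
      have h2 := congrArg (fun y => CliffordAlgebra.involute (↑x⁻¹ : Cl n) * y * (↑x⁻¹ : Cl n)) h
      rw [← mul_assoc, hi', one_mul, mul_assoc, mul_assoc, Units.mul_inv, mul_one] at h2
      exact h2.symm
    · simpa using hA2'
    · rw [Matrix.det_transpose]
      refine hA3.imp (fun h => ⟨?_, h.2⟩) (fun h => ⟨?_, h.2⟩)
      · have h1 := hi
        rw [h.1] at h1
        exact (Units.eq_inv_of_mul_eq_one_left h1)
      · have h1 := hi
        rw [h.1, neg_mul, ← mul_neg] at h1
        exact neg_eq_iff_eq_neg.1 (Units.eq_inv_of_mul_eq_one_left h1)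

theorem exists_rotation {n : ℕ} (a : Spin n) :
    ∃ A : SO n, ∀ v, (a : Cl n) * vec n v = vec n ((A : Matrix (Fin n) (Fin n) ℝ).mulVec v) * a := by
  let x : (Cl n)ˣ := ⟨a, ↑a⁻¹, spinGroup.coe_mul_star_self a, spinGroup.coe_star_mul_self a⟩
  obtain ⟨A, h1, h2, h3⟩ := exists_induces x (spinGroup.units_mem_lipschitzGroup (x := x) a.2)
  have hinv : CliffordAlgebra.involute (x : Cl n) = x := spinGroup.involute_eq a.2
  have hdet : A.det = 1 := by
    rcases h3 with h3 | h3
    · exact h3.2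
    · exfalso
      have h4 : (x : Cl n) + x = 0 := by
        nth_rewrite 1 [← hinv]
        rw [h3.1, neg_add_cancel]
      rw [← two_smul ℝ (x : Cl n), smul_eq_zero] at h4
      exact x.ne_zero (h4.resolve_left two_ne_zero)
  rw [hinv] at h1
  exact ⟨⟨A, Matrix.mem_specialOrthogonalGroup_iff.2
    ⟨(Matrix.mem_orthogonalGroup_iff (Fin n) ℝ).2 h2, hdet⟩⟩, h1⟩

theorem rotation_unique {n : ℕ} (a : Spin n) {A B : SO n}
    (hA : ∀ v, (a : Cl n) * vec n v = vec n ((A : Matrix (Fin n) (Fin n) ℝ).mulVec v) * a)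
    (hB : ∀ v, (a : Cl n) * vec n v = vec n ((B : Matrix (Fin n) (Fin n) ℝ).mulVec v) * a) :
    A = B := by
  apply Subtype.ext
  apply Matrix.mulVec_injective
  funext v
  apply vec_injective
  have h := (hA v).symm.trans (hB v)
  have h2 := congrArg (fun y => y * star (a : Cl n)) h
  simpa [mul_assoc] using h2

/-- The double covering `ρₙ : Spin(n) → SO(n)`, given by `a v a⁻¹ = ρₙ(a) v` in the Clifford
algebra; see `spinToSO_spec`. -/
noncomputable def spinToSO (n : ℕ) : Spin n →* SO n where
  toFun a := Classical.choose (exists_rotation a)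
  map_one' := rotation_unique 1 (Classical.choose_spec (exists_rotation 1)) (by simp)
  map_mul' a b := rotation_unique (a * b) (Classical.choose_spec (exists_rotation (a * b))) (by
    intro v
    have ha := Classical.choose_spec (exists_rotation a)
    have hb := Classical.choose_spec (exists_rotation b)
    rw [Submonoid.coe_mul, Submonoid.coe_mul, mul_assoc, hb, ← mul_assoc, ha, mul_assoc,
      Matrix.mulVec_mulVec])

theorem spinToSO_spec {n : ℕ} (a : Spin n) (v : Fin n → ℝ) :
    (a : Cl n) * vec n v = vec n ((spinToSO n a : Matrix (Fin n) (Fin n) ℝ).mulVec v) * a :=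
  Classical.choose_spec (exists_rotation a) v

/-! ### The groups -/

/-- The group `GL⁺(2, ℝ)`. -/
abbrev GL2Plus : Type := Matrix.GLPos (Fin 2) ℝ

/-- The subgroup `{(1, 1), (-1, -1)}` of `U(1) × Spin(n)`. -/
def spinCKernel (n : ℕ) : Subgroup (Circle × Spin n) where
  carrier := {p | (p.1 = 1 ∧ (p.2 : Cl n) = 1) ∨ (p.1 = -1 ∧ (p.2 : Cl n) = -1)}
  one_mem' := Or.inl ⟨rfl, rfl⟩
  mul_mem' := by
    rintro p q (⟨h1, h2⟩ | ⟨h1, h2⟩) (⟨h3, h4⟩ | ⟨h3, h4⟩) <;>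
      simp only [Set.mem_ofPred_eq, Prod.fst_mul, Prod.snd_mul, Submonoid.coe_mul, h1, h2, h3, h4,
        one_mul, mul_one, neg_mul, neg_neg, and_self, true_or, or_true]
  inv_mem' := by
    rintro p (⟨h1, h2⟩ | ⟨h1, h2⟩)
    · left
      refine ⟨by simp [h1], ?_⟩
      rw [Prod.snd_inv, ← spinGroup.star_eq_inv, spinGroup.coe_star, h2, star_one]
    · right
      refine ⟨by rw [Prod.fst_inv, h1, inv_neg, inv_one], ?_⟩
      rw [Prod.snd_inv, ← spinGroup.star_eq_inv, spinGroup.coe_star, h2, star_neg, star_one]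

instance (n : ℕ) : (spinCKernel n).Normal where
  conj_mem p hp g := by
    have hg : (g.2 : Cl n) * ((g.2⁻¹ : Spin n) : Cl n) = 1 := spinGroup.coe_mul_star_self g.2
    rcases hp with ⟨h1, h2⟩ | ⟨h1, h2⟩
    · exact Or.inl ⟨by simp [h1], by simp [h2, hg]⟩
    · exact Or.inr ⟨by simp [h1], by simp [h2, hg]⟩

/-- The group `Spinᶜ(n)`, the quotient of `U(1) × Spin(n)` by `{±(1, 1)}`. -/
abbrev SpinC (n : ℕ) : Type := (Circle × Spin n) ⧸ spinCKernel n

/-- The element `⟨z, a⟩` of `Spinᶜ(n)`. -/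
noncomputable def SpinC.mk {n : ℕ} (z : Circle) (a : Spin n) : SpinC n := QuotientGroup.mk (z, a)

theorem spinToSO_of_eq {n : ℕ} (a : Spin n) (h : (a : Cl n) = 1 ∨ (a : Cl n) = -1) :
    spinToSO n a = 1 := by
  refine rotation_unique a (spinToSO_spec a) (fun v => ?_)
  rcases h with h | h <;> simp [h]

/-- The homomorphism `ρₙᶜ : Spinᶜ(n) → SO(n)`, `⟨z, a⟩ ↦ ρₙ(a)`. -/
noncomputable def spinCToSO (n : ℕ) : SpinC n →* SO n :=
  QuotientGroup.lift (spinCKernel n) ((spinToSO n).comp (MonoidHom.snd Circle (Spin n))) (by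
    rintro p (⟨_, h⟩ | ⟨_, h⟩)
    · exact spinToSO_of_eq p.2 (Or.inl h)
    · exact spinToSO_of_eq p.2 (Or.inr h))

/-- The homomorphism `ςₙ : Spinᶜ(n) → U(1)`, `⟨z, a⟩ ↦ z²`. -/
noncomputable def spinCDet (n : ℕ) : SpinC n →* Circle :=
  QuotientGroup.lift (spinCKernel n)
    ((powMonoidHom 2).comp (MonoidHom.fst Circle (Spin n))) (by
    rintro p (⟨h, _⟩ | ⟨h, _⟩) <;> simp [h])

/-- `G₀ = GL⁺(2, ℝ) × SO(n)`. -/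
abbrev G0 (n : ℕ) : Type := GL2Plus × SO n
/-- `G̃₀ = GL⁺(2, ℝ) × Spin(n)`. -/
abbrev G0Tilde (n : ℕ) : Type := GL2Plus × Spin n
/-- `G₀ᶜ = GL⁺(2, ℝ) × Spinᶜ(n)`. -/
abbrev G0C (n : ℕ) : Type := GL2Plus × SpinC n

/-- The inclusion `(A, a) ↦ (A, ⟨1, a⟩)` of `G̃₀` in `G₀ᶜ`. -/
noncomputable def G0Tilde.toG0C {n : ℕ} (g : G0Tilde n) : G0C n := (g.1, SpinC.mk 1 g.2)

/-! ### Smooth maps into the groups -/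

/-- Coordinate functions on a group `G` that is an embedded Lie subgroup of (the units of) a finite
dimensional real algebra: the restrictions to `G` of the linear coordinates of that algebra. A map
into `G` is smooth if and only if its composites with all of them are smooth. Only the instances
below are used. -/
class SmoothCoords (G : Type*) where
  coords : Set (G → ℝ)

/-- Smoothness, over the open set `Ω` of a Euclidean space, of a map into the Lie group `G`. -/
def SmoothIntoOn {G : Type*} [SmoothCoords G] {k : ℕ} (g : EuclideanSpace ℝ (Fin k) → G)
    (Ω : Set (EuclideanSpace ℝ (Fin k))) : Prop :=
  ∀ c ∈ SmoothCoords.coords (G := G), ContDiffOn ℝ ∞ (fun y => c (g y)) Ω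

instance : SmoothCoords Circle where
  coords := {fun z : Circle => (z : ℂ).re, fun z : Circle => (z : ℂ).im}

instance : SmoothCoords GL2Plus where
  coords := {c | ∃ i j, c = fun A : GL2Plus => ((A : GL (Fin 2) ℝ) : Matrix (Fin 2) (Fin 2) ℝ) i j}

instance (n : ℕ) : SmoothCoords (SO n) where
  coords := {c | ∃ i j, c = fun A : SO n => (A : Matrix (Fin n) (Fin n) ℝ) i j}

instance (n : ℕ) : SmoothCoords (Spin n) where
  coords := {c | ∃ l : Cl n →ₗ[ℝ] ℝ, c = fun a : Spin n => l (a : Cl n)}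

open scoped TensorProduct in
/-- `Spinᶜ(n)` is embedded in `ℂ ⊗ Cl(n)` by `⟨z, a⟩ ↦ z ⊗ a`. -/
instance (n : ℕ) : SmoothCoords (SpinC n) where
  coords := {c | ∃ l : (ℂ ⊗[ℝ] Cl n) →ₗ[ℝ] ℝ, ∀ (z : Circle) (a : Spin n),
    c (SpinC.mk z a) = l ((z : ℂ) ⊗ₜ[ℝ] (a : Cl n))}

instance (G K : Type*) [SmoothCoords G] [SmoothCoords K] : SmoothCoords (G × K) where
  coords := {c | (∃ d ∈ SmoothCoords.coords (G := G), c = fun p => d p.1) ∨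
    ∃ d ∈ SmoothCoords.coords (G := K), c = fun p => d p.2}

/-! ### Principal bundles -/

/-- A smooth principal `G`-bundle `proj : P → M` with right action `act`. The manifolds `P` and `M`
have dimensions `d` and `m`. The action is free with the fibres of `proj` as its orbits; the last
four fields say that `proj` and the action `P × G → P` are smooth (the latter tested on smooth maps
from open sets of Euclidean spaces into `P × G`), that there are smooth local sections and that
`g ∈ G` depends smoothly on the pair `(u, u g)`. With a local section `σ` over `U` the map
`(x, g) ↦ σ(x) g` is thus a diffeomorphism from `U × G` onto `proj⁻¹(U)`. -/
structure PrincipalBundle (G : Type*) [Group G] [SmoothCoords G] (d m : ℕ)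
    (P : Type*) [TopologicalSpace P] [ChartedSpace (EuclideanSpace ℝ (Fin d)) P]
    (M : Type*) [TopologicalSpace M] [ChartedSpace (EuclideanSpace ℝ (Fin m)) M] where
  proj : P → M
  act : P → G → P
  act_one : ∀ u, act u 1 = u
  act_mul : ∀ u g h, act u (g * h) = act (act u g) h
  free : ∀ u g, act u g = u → g = 1
  proj_eq_iff : ∀ u v, proj u = proj v ↔ ∃ g, v = act u g
  smooth_proj : ContMDiff (𝓡 d) (𝓡 m) ∞ proj
  smooth_act : ∀ (k : ℕ) (Ω : Set (EuclideanSpace ℝ (Fin k))), IsOpen Ω →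
    ∀ (p : EuclideanSpace ℝ (Fin k) → P) (g : EuclideanSpace ℝ (Fin k) → G),
      ContMDiffOn (𝓡 k) (𝓡 d) ∞ p Ω → SmoothIntoOn g Ω →
        ContMDiffOn (𝓡 k) (𝓡 d) ∞ (fun y => act (p y) (g y)) Ω
  exists_section : ∀ x : M, ∃ (U : Set M) (σ : M → P), IsOpen U ∧ x ∈ U ∧
    ContMDiffOn (𝓡 m) (𝓡 d) ∞ σ U ∧ ∀ y ∈ U, proj (σ y) = y
  smooth_div : ∀ (k : ℕ) (Ω : Set (EuclideanSpace ℝ (Fin k))), IsOpen Ω →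
    ∀ (p p' : EuclideanSpace ℝ (Fin k) → P) (g : EuclideanSpace ℝ (Fin k) → G),
      ContMDiffOn (𝓡 k) (𝓡 d) ∞ p Ω → ContMDiffOn (𝓡 k) (𝓡 d) ∞ p' Ω →
        (∀ y ∈ Ω, p' y = act (p y) (g y)) → SmoothIntoOn g Ω

theorem PrincipalBundle.surjective_proj {G : Type*} [Group G] [SmoothCoords G] {d m : ℕ}
    {P : Type*} [TopologicalSpace P] [ChartedSpace (EuclideanSpace ℝ (Fin d)) P]
    {M : Type*} [TopologicalSpace M] [ChartedSpace (EuclideanSpace ℝ (Fin m)) M]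
    (B : PrincipalBundle G d m P M) : Function.Surjective B.proj := fun x =>
  let ⟨_, σ, _, hx, _, h⟩ := B.exists_section x
  ⟨σ x, h x hx⟩

theorem PrincipalBundle.smooth_act_right {G : Type*} [Group G] [SmoothCoords G] {d m : ℕ}
    {P : Type*} [TopologicalSpace P] [ChartedSpace (EuclideanSpace ℝ (Fin d)) P]
    [IsManifold (𝓡 d) ∞ P]
    {M : Type*} [TopologicalSpace M] [ChartedSpace (EuclideanSpace ℝ (Fin m)) M]
    (B : PrincipalBundle G d m P M) (g : G) : ContMDiff (𝓡 d) (𝓡 d) ∞ (fun u => B.act u g) := by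
  intro u
  have h := B.smooth_act d (extChartAt (𝓡 d) u).target (isOpen_extChartAt_target u)
    (extChartAt (𝓡 d) u).symm (fun _ => g) (contMDiffOn_extChartAt_symm u)
    (fun c _ => contDiffOn_const)
  have h2 := h.comp (contMDiffOn_extChartAt (I := 𝓡 d) (n := ∞) (x := u))
    (fun y hy => (extChartAt (𝓡 d) u).map_source (by rwa [extChartAt_source]))
  have h3 : ContMDiffOn (𝓡 d) (𝓡 d) ∞ (fun u => B.act u g) (chartAt (EuclideanSpace ℝ (Fin d)) u).source := by
    refine h2.congr (fun y hy => ?_)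
    simp only [Function.comp]
    rw [(extChartAt (𝓡 d) u).left_inv (by rwa [extChartAt_source])]
  exact h3.contMDiffAt ((chartAt (EuclideanSpace ℝ (Fin d)) u).open_source.mem_nhds (mem_chart_source _ u))

/-! ### Associated bundles and their sections -/

section Associated

variable {G : Type*} [Group G] [SmoothCoords G] {d m : ℕ}
  {P : Type*} [TopologicalSpace P] [ChartedSpace (EuclideanSpace ℝ (Fin d)) P]
  {M : Type*} [TopologicalSpace M] [ChartedSpace (EuclideanSpace ℝ (Fin m)) M]
  (B : PrincipalBundle G d m P M)
  {V : Type*} [NormedAddCommGroup V] [NormedSpace ℂ V] (ρ : G →* (V →ₗ[ℂ] V))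

/-- The relation `(u g, v) ∼ (u, ρ(g) v)`. -/
def assocSetoid : Setoid (P × V) where
  r a b := ∃ g, b.1 = B.act a.1 g ∧ b.2 = ρ g⁻¹ a.2
  iseqv :=
    { refl := fun a => ⟨1, by simp [B.act_one], by simp⟩
      symm := by
        rintro ⟨u, v⟩ ⟨u', v'⟩ ⟨g, rfl, rfl⟩
        refine ⟨g⁻¹, ?_, ?_⟩
        · simp [← B.act_mul, B.act_one]
        · simp [← Module.End.mul_apply, ← map_mul]
      trans := by
        rintro ⟨u, v⟩ ⟨u', v'⟩ ⟨u'', v''⟩ ⟨g, rfl, rfl⟩ ⟨h, rfl, rfl⟩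
        exact ⟨g * h, by simp [B.act_mul], by simp⟩ }

/-- The total space `P ×_G V` of the associated vector bundle. -/
def Assoc : Type _ := Quotient (assocSetoid B ρ)

/-- The class `[u, v]` of `(u, v)` in `P ×_G V`. -/
def Assoc.mk (u : P) (v : V) : Assoc B ρ := Quotient.mk (assocSetoid B ρ) (u, v)

theorem Assoc.mk_act (u : P) (g : G) (v : V) :
    Assoc.mk B ρ (B.act u g) (ρ g⁻¹ v) = Assoc.mk B ρ u v :=
  (Quotient.sound (s := assocSetoid B ρ) ⟨g, rfl, rfl⟩).symm

theorem Assoc.mk_injective (u : P) : Function.Injective (Assoc.mk B ρ u) := by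
  intro v w h
  obtain ⟨g, h1, h2⟩ := Quotient.exact h
  have hg : g = 1 := B.free u g h1.symm
  simpa [hg] using h2.symm

/-- The projection `P ×_G V → M`. -/
def Assoc.proj : Assoc B ρ → M :=
  Quotient.lift (s := assocSetoid B ρ) (fun a => B.proj a.1) (by
    rintro ⟨u, v⟩ ⟨u', v'⟩ ⟨g, rfl, rfl⟩
    exact (B.proj_eq_iff _ _).2 ⟨g, rfl⟩)

/-- Smooth sections of the associated bundle `P ×_G V → M`. Smoothness of a section is the
smoothness of the function `f : P → V` with `s(proj u) = [u, f(u)]`; as `proj` has smooth local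
sections `σ`, this is the smoothness of `s` in the local trivializations
`(x, v) ↦ [σ(x), v]`. -/
structure AssocSection where
  toFun : M → Assoc B ρ
  proj_toFun : ∀ x, Assoc.proj B ρ (toFun x) = x
  smooth' : ∃ f : P → V, ContMDiff (𝓡 d) 𝓘(ℝ, V) ∞ f ∧
    ∀ u, toFun (B.proj u) = Assoc.mk B ρ u (f u)

/-- The smooth functions `f : P → V` with `f(u g) = ρ(g)⁻¹ f(u)`. -/
def EquivariantFun : Submodule ℂ (P → V) where
  carrier := {f | ContMDiff (𝓡 d) 𝓘(ℝ, V) ∞ f ∧ ∀ u g, f (B.act u g) = ρ g⁻¹ (f u)}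
  zero_mem' := ⟨contMDiff_const, fun _ _ => (map_zero _).symm⟩
  add_mem' := fun hf hg => ⟨hf.1.add hg.1, fun u g => by
    simp only [Pi.add_apply, hf.2 u g, hg.2 u g, map_add]⟩
  smul_mem' := fun c f hf => ⟨(contDiff_const_smul (𝕜 := ℝ) (n := ∞) c).contMDiff.comp hf.1, fun u g => by
    simp only [Pi.smul_apply, hf.2 u g, map_smul]⟩

variable {B ρ}

namespace AssocSection

/-- The function `f : P → V` with `s(proj u) = [u, f(u)]`. -/
noncomputable def frameFun (s : AssocSection B ρ) : P → V := Classical.choose s.smooth'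

theorem frameFun_smooth (s : AssocSection B ρ) : ContMDiff (𝓡 d) 𝓘(ℝ, V) ∞ s.frameFun :=
  (Classical.choose_spec s.smooth').1

theorem toFun_proj (s : AssocSection B ρ) (u : P) :
    s.toFun (B.proj u) = Assoc.mk B ρ u (s.frameFun u) :=
  (Classical.choose_spec s.smooth').2 u

theorem frameFun_act (s : AssocSection B ρ) (u : P) (g : G) :
    s.frameFun (B.act u g) = ρ g⁻¹ (s.frameFun u) := by
  apply Assoc.mk_injective B ρ (B.act u g)
  rw [← toFun_proj, Assoc.mk_act, ← toFun_proj]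
  exact congrArg _ ((B.proj_eq_iff _ _).2 ⟨g, rfl⟩).symm

/-- The section `proj u ↦ [u, f(u)]` that belongs to an equivariant function. -/
noncomputable def ofFun (f : EquivariantFun B ρ) : AssocSection B ρ where
  toFun x := Assoc.mk B ρ (Function.surjInv B.surjective_proj x)
    (f.1 (Function.surjInv B.surjective_proj x))
  proj_toFun x := Function.surjInv_eq B.surjective_proj x
  smooth' := ⟨f.1, f.2.1, fun u => by
    obtain ⟨g, hg⟩ := (B.proj_eq_iff u (Function.surjInv B.surjective_proj (B.proj u))).1
      (Function.surjInv_eq B.surjective_proj (B.proj u)).symm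
    rw [hg, f.2.2, Assoc.mk_act]⟩

theorem frameFun_ofFun (f : EquivariantFun B ρ) : (ofFun f).frameFun = f.1 := by
  funext u
  apply Assoc.mk_injective B ρ u
  rw [← toFun_proj]
  change Assoc.mk B ρ _ _ = _
  obtain ⟨g, hg⟩ := (B.proj_eq_iff u (Function.surjInv B.surjective_proj (B.proj u))).1
    (Function.surjInv_eq B.surjective_proj (B.proj u)).symm
  rw [hg, f.2.2, Assoc.mk_act]

theorem frameFun_injective :
    Function.Injective (frameFun : AssocSection B ρ → P → V) := by
  intro s t h
  have h2 : s.toFun = t.toFun := by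
    funext x
    obtain ⟨u, rfl⟩ := B.surjective_proj x
    rw [toFun_proj, toFun_proj, h]
  cases s
  cases t
  cases h2
  rfl

/-- The canonical identification of sections with smooth equivariant functions on `P`. -/
noncomputable def equivFun : AssocSection B ρ ≃ EquivariantFun B ρ where
  toFun s := ⟨s.frameFun, s.frameFun_smooth, s.frameFun_act⟩
  invFun := ofFun
  left_inv _ := frameFun_injective (frameFun_ofFun _)
  right_inv f := Subtype.ext (frameFun_ofFun f)

/-- The fibrewise linear structure `[u, v] + [u, w] = [u, v + w]`. -/
noncomputable instance : AddCommGroup (AssocSection B ρ) := equivFun.addCommGroup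

/-- The fibrewise linear structure `c [u, v] = [u, c v]`. -/
noncomputable instance : Module ℂ (AssocSection B ρ) := equivFun.module ℂ

end AssocSection

/-- The `k`-jet of `f` at `u` vanishes: in the chart at `u`, all derivatives of order at most `k`
are zero. -/
def JetVanishes (k : ℕ) (f : P → V) (u : P) : Prop :=
  ∀ j ≤ k, iteratedFDeriv ℝ j (f ∘ (extChartAt (𝓡 d) u).symm) (extChartAt (𝓡 d) u u) = 0

/-- A linear differential operator of finite order between sections of associated bundles: there is
a `k` such that `D s` is zero at every point `x` at which the `k`-jet of `s` vanishes. The `k`-jet of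
`s` at `x` vanishes if and only if that of the equivariant function of `s` does at the points of
`P` over `x`. -/
def IsDifferentialOperator {W : Type*} [NormedAddCommGroup W] [NormedSpace ℂ W]
    {ϑ : G →* (W →ₗ[ℂ] W)} (D : AssocSection B ρ →ₗ[ℂ] AssocSection B ϑ) : Prop :=
  ∃ k : ℕ, ∀ (s : AssocSection B ρ) (x : M),
    (∀ u, B.proj u = x → JetVanishes (d := d) k s.frameFun u) →
      (D s).toFun x = (0 : AssocSection B ϑ).toFun x

end Associated

/-! ### Calculus on manifolds -/

section Calculus

variable {d : ℕ} {M : Type*} [TopologicalSpace M] [ChartedSpace (EuclideanSpace ℝ (Fin d)) M]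

/-- The derivative of a vector valued function along a tangent vector. -/
noncomputable def dirDeriv {E : Type*} [NormedAddCommGroup E] [NormedSpace ℝ E] (f : M → E) (x : M)
    (v : TangentSpace (𝓡 d) x) : E :=
  mfderiv (𝓡 d) 𝓘(ℝ, E) f x v

def IsSmoothVectorField [IsManifold (𝓡 d) ∞ M] (X : ∀ x : M, TangentSpace (𝓡 d) x) : Prop :=
  ContMDiff (𝓡 d) (𝓡 d).tangent ∞ (fun x => (⟨x, X x⟩ : TangentBundle (𝓡 d) M))

def IsSmoothOneForm [IsManifold (𝓡 d) ∞ M] (α : ∀ x : M, TangentSpace (𝓡 d) x →ₗ[ℝ] ℝ) : Prop :=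
  ContMDiff (𝓡 d).tangent 𝓘(ℝ, ℝ) ∞ (fun v : TangentBundle (𝓡 d) M => α v.proj v.snd)

/-- `dα(X, Y)` at `x`. -/
noncomputable def extDerivOne (α : ∀ x : M, TangentSpace (𝓡 d) x →ₗ[ℝ] ℝ)
    (X Y : ∀ x : M, TangentSpace (𝓡 d) x) (x : M) : ℝ :=
  dirDeriv (fun y => α y (Y y)) x (X x) - dirDeriv (fun y => α y (X y)) x (Y x)
    - α x (VectorField.mlieBracket (𝓡 d) X Y x)

/-- `dβ(X, Y, Z)` at `x`. -/
noncomputable def extDerivTwo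
    (β : ∀ x : M, TangentSpace (𝓡 d) x →ₗ[ℝ] TangentSpace (𝓡 d) x →ₗ[ℝ] ℝ)
    (X Y Z : ∀ x : M, TangentSpace (𝓡 d) x) (x : M) : ℝ :=
  dirDeriv (fun y => β y (Y y) (Z y)) x (X x)
    + dirDeriv (fun y => β y (Z y) (X y)) x (Y x)
    + dirDeriv (fun y => β y (X y) (Y y)) x (Z x)
    - β x (VectorField.mlieBracket (𝓡 d) X Y x) (Z x)
    - β x (VectorField.mlieBracket (𝓡 d) Y Z x) (X x)
    - β x (VectorField.mlieBracket (𝓡 d) Z X x) (Y x)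

end Calculus

/-! ### The graded nilpotent Lie algebra and the action of the Levi group -/

/-- `𝔤₋₁`, the space of real `n × 2` matrices. -/
abbrev GMinusOne (n : ℕ) : Type := Fin n → Fin 2 → ℝ

/-- The bracket `𝔤₋₁ × 𝔤₋₁ → 𝔤₋₂`, `(X, Y) ↦ Yᵀ X - Xᵀ Y`. The space `𝔤₋₂` of skew-symmetric
`2 × 2` matrices is identified with `ℝ` by the upper right entry. -/
def leviForm {n : ℕ} (X Y : GMinusOne n) : ℝ :=
  ((Matrix.of Y).transpose * Matrix.of X - (Matrix.of X).transpose * Matrix.of Y) 0 1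

/-- The adjoint action `X ↦ B X A⁻¹` of `(A, B) ∈ G₀` on `𝔤₋₁`. -/
noncomputable def adMinusOne {n : ℕ} (g : G0 n) (X : GMinusOne n) : GMinusOne n :=
  Matrix.of.symm ((g.2 : Matrix (Fin n) (Fin n) ℝ) * Matrix.of X *
    (((g.1⁻¹ : GL2Plus) : GL (Fin 2) ℝ) : Matrix (Fin 2) (Fin 2) ℝ))

noncomputable def G0Tilde.toG0 {n : ℕ} (g : G0Tilde n) : G0 n := (g.1, spinToSO n g.2)

noncomputable def G0C.toG0 {n : ℕ} (g : G0C n) : G0 n := (g.1, spinCToSO n g.2)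

/-! ### PCS-structures of Grassmannian type -/

/-- A `G₀`-structure `(𝒢₀, M, p₀, θ)` on the manifold `M` of dimension `2n`, which is the same as a
PACS-structure of Grassmannian type. Here `Q` is the total space `𝒢₀`, and `frame w` is the linear
isomorphism `𝔤₋₁ → T_{p₀(w)} M` with `θ_w(Y) = (frame w)⁻¹ (T p₀ · Y)`. -/
structure G0Structure (n e : ℕ)
    (Q : Type*) [TopologicalSpace Q] [ChartedSpace (EuclideanSpace ℝ (Fin e)) Q]
    (M : Type*) [TopologicalSpace M] [ChartedSpace (EuclideanSpace ℝ (Fin (2 * n))) M]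
    [IsManifold (𝓡 (2 * n)) ∞ M] where
  bundle : PrincipalBundle (G0 n) e (2 * n) Q M
  frame : ∀ w : Q, GMinusOne n ≃ₗ[ℝ] TangentSpace (𝓡 (2 * n)) (bundle.proj w)
  frame_act : ∀ w g X,
    (⟨bundle.proj (bundle.act w g), frame (bundle.act w g) X⟩ : TangentBundle (𝓡 (2 * n)) M) =
      ⟨bundle.proj w, frame w (adMinusOne g X)⟩
  frame_smooth : ∀ X, ContMDiff (𝓡 e) (𝓡 (2 * n)).tangent ∞
    (fun w => (⟨bundle.proj w, frame w X⟩ : TangentBundle (𝓡 (2 * n)) M))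

section PCS

variable {n e : ℕ} {Q : Type*} [TopologicalSpace Q] [ChartedSpace (EuclideanSpace ℝ (Fin e)) Q]
  {M : Type*} [TopologicalSpace M] [ChartedSpace (EuclideanSpace ℝ (Fin (2 * n))) M]
  [IsManifold (𝓡 (2 * n)) ∞ M]

/-- Over the open set `U`, `β` is a smooth section of the line bundle `ℓ ⊂ Λ² T*M` of the
PACS-structure and it is closed as a 2-form. In each frame from `𝒢₀` the line `ℓ` is spanned by the
bracket `𝔤₋₁ × 𝔤₋₁ → 𝔤₋₂ ≅ ℝ`. -/
structure IsClosedSection (S : G0Structure n e Q M) (U : Set M)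
    (β : ∀ x : M, TangentSpace (𝓡 (2 * n)) x →ₗ[ℝ] TangentSpace (𝓡 (2 * n)) x →ₗ[ℝ] ℝ) :
    Prop where
  smooth : ∀ X Y : ∀ x : M, TangentSpace (𝓡 (2 * n)) x, IsSmoothVectorField X →
    IsSmoothVectorField Y → ContMDiffOn (𝓡 (2 * n)) 𝓘(ℝ, ℝ) ∞ (fun x => β x (X x) (Y x)) U
  mem_line : ∀ w : Q, S.bundle.proj w ∈ U → ∃ c : ℝ, ∀ X Y : GMinusOne n,
    β (S.bundle.proj w) (S.frame w X) (S.frame w Y) = c * leviForm X Y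
  closed : ∀ X Y Z : ∀ x : M, TangentSpace (𝓡 (2 * n)) x, IsSmoothVectorField X →
    IsSmoothVectorField Y → IsSmoothVectorField Z → ∀ x ∈ U, extDerivTwo β X Y Z x = 0

/-- The `G₀`-structure belongs to a PCS-structure of Grassmannian type: the line bundle `ℓ` is a
conformally symplectic structure, i.e. it has nowhere vanishing closed local sections. -/
def IsPCS (S : G0Structure n e Q M) : Prop :=
  ∀ x : M, ∃ U : Set M, IsOpen U ∧ x ∈ U ∧
    ∃ β : ∀ x : M, TangentSpace (𝓡 (2 * n)) x →ₗ[ℝ] TangentSpace (𝓡 (2 * n)) x →ₗ[ℝ] ℝ,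
      IsClosedSection S U β ∧ ∀ y ∈ U, β y ≠ 0

end PCS

/-! ### Lie contact structures of type `(G̃, P̃)` -/

/-- A Lie contact structure of type `(G̃, P̃)` on the manifold `N` of dimension `2n + 1` with contact
distribution `H`: a principal `G̃₀`-bundle `P → N` and a smooth map that sends `u ∈ P` to a frame
`frame u : 𝔤₋₁ → H` of `H` at the base point of `u`, equivariant for the homomorphism
`G̃₀ → G₀ → Aut_gr(𝔤₋)`, and such that `frame u` is (the restriction to `𝔤₋₁` of) an isomorphism of
graded Lie algebras `𝔤₋ → gr(TN) = TN/H ⊕ H`. Here `gr(TN)` carries the Levi bracket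
`(Y, Z) ↦ [Y, Z] mod H`, `𝔤₋₂` is identified with `ℝ`, and a graded isomorphism is determined by its
restriction to `𝔤₋₁`. The inverse of `frame u` is the tautological partial form `θ₋₁` at `u`, and
`P / {±1}` is the underlying `G₀`-bundle. -/
structure LieContactStructure (n d : ℕ)
    (P : Type*) [TopologicalSpace P] [ChartedSpace (EuclideanSpace ℝ (Fin d)) P]
    (N : Type*) [TopologicalSpace N] [ChartedSpace (EuclideanSpace ℝ (Fin (2 * n + 1))) N]
    [IsManifold (𝓡 (2 * n + 1)) ∞ N] where
  bundle : PrincipalBundle (G0Tilde n) d (2 * n + 1) P N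
  H : ∀ x : N, Submodule ℝ (TangentSpace (𝓡 (2 * n + 1)) x)
  frame : ∀ u : P, GMinusOne n →ₗ[ℝ] TangentSpace (𝓡 (2 * n + 1)) (bundle.proj u)
  frame_injective : ∀ u, Function.Injective (frame u)
  range_frame : ∀ u, LinearMap.range (frame u) = H (bundle.proj u)
  frame_act : ∀ u g X,
    (⟨bundle.proj (bundle.act u g), frame (bundle.act u g) X⟩ :
        TangentBundle (𝓡 (2 * n + 1)) N) =
      ⟨bundle.proj u, frame u (adMinusOne g.toG0 X)⟩
  frame_smooth : ∀ X, ContMDiff (𝓡 d) (𝓡 (2 * n + 1)).tangent ∞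
    (fun u => (⟨bundle.proj u, frame u X⟩ : TangentBundle (𝓡 (2 * n + 1)) N))
  graded_iso : ∀ u, ∃ φ : ℝ ≃ₗ[ℝ] (TangentSpace (𝓡 (2 * n + 1)) (bundle.proj u) ⧸
      H (bundle.proj u)),
    ∀ (Y Z : ∀ x : N, TangentSpace (𝓡 (2 * n + 1)) x),
      IsSmoothVectorField Y → IsSmoothVectorField Z → (∀ x, Y x ∈ H x) → (∀ x, Z x ∈ H x) →
      ∀ X X' : GMinusOne n, Y (bundle.proj u) = frame u X → Z (bundle.proj u) = frame u X' →
        (H (bundle.proj u)).mkQ (VectorField.mlieBracket (𝓡 (2 * n + 1)) Y Z (bundle.proj u)) =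
          φ (leviForm X X')

section Symmetry

variable {n d : ℕ} {P : Type*} [TopologicalSpace P] [ChartedSpace (EuclideanSpace ℝ (Fin d)) P]
  [IsManifold (𝓡 d) ∞ P]
  {N : Type*} [TopologicalSpace N] [ChartedSpace (EuclideanSpace ℝ (Fin (2 * n + 1))) N]
  [IsManifold (𝓡 (2 * n + 1)) ∞ N]

/-- `ξ` is an infinitesimal symmetry of the Lie contact structure and `ξ₀` is its lift to `P`: the
`G̃₀`-invariant vector field `ξ₀` projects to `ξ` and preserves the partial form `θ₋₁`, that is, if
`Y` projects into `H`, then so does `[ξ₀, Y]`, and `θ₋₁([ξ₀, Y]) = ξ₀ · θ₋₁(Y)`. In the last field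
`h = θ₋₁(Y)`. -/
structure IsInfinitesimalSymmetry (L : LieContactStructure n d P N)
    (ξ : ∀ x : N, TangentSpace (𝓡 (2 * n + 1)) x) (ξ₀ : ∀ u : P, TangentSpace (𝓡 d) u) :
    Prop where
  smooth : IsSmoothVectorField ξ
  smooth_lift : IsSmoothVectorField ξ₀
  projects : ∀ u, mfderiv (𝓡 d) (𝓡 (2 * n + 1)) L.bundle.proj u (ξ₀ u) = ξ (L.bundle.proj u)
  invariant : ∀ u g, mfderiv (𝓡 d) (𝓡 d) (fun v => L.bundle.act v g) u (ξ₀ u) =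
    ξ₀ (L.bundle.act u g)
  preserves : ∀ (Y : ∀ u : P, TangentSpace (𝓡 d) u) (h : P → GMinusOne n),
    IsSmoothVectorField Y → ContMDiff (𝓡 d) 𝓘(ℝ, GMinusOne n) ∞ h →
    (∀ u, mfderiv (𝓡 d) (𝓡 (2 * n + 1)) L.bundle.proj u (Y u) = L.frame u (h u)) →
    ∀ u, mfderiv (𝓡 d) (𝓡 (2 * n + 1)) L.bundle.proj u
      (VectorField.mlieBracket (𝓡 d) ξ₀ Y u) = L.frame u (dirDeriv h u (ξ₀ u))

variable {V : Type*} [NormedAddCommGroup V] [NormedSpace ℂ V] [FiniteDimensional ℂ V]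
  {ρ : G0Tilde n →* (V →ₗ[ℂ] V)} {L : LieContactStructure n d P N}
  {ξ : ∀ x : N, TangentSpace (𝓡 (2 * n + 1)) x} {ξ₀ : ∀ u : P, TangentSpace (𝓡 d) u}

/-- Differentiating an equivariant function along `ξ₀` gives an equivariant function. -/
theorem IsInfinitesimalSymmetry.dirDeriv_mem (hξ : IsInfinitesimalSymmetry L ξ ξ₀)
    (f : EquivariantFun L.bundle ρ) :
    (fun u => dirDeriv f.1 u (ξ₀ u)) ∈ EquivariantFun L.bundle ρ := by
  refine ⟨?_, fun u g => ?_⟩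
  · have h1 : ContMDiff (𝓡 d).tangent (𝓘(ℝ, V)).tangent ∞
        (tangentMap (𝓡 d) 𝓘(ℝ, V) f.1) := f.2.1.contMDiff_tangentMap (by simp)
    exact contMDiff_snd_tangentBundle_modelSpace V 𝓘(ℝ, V) |>.comp (h1.comp hξ.smooth_lift)
  · have hR := ((L.bundle.smooth_act_right g) u).mdifferentiableAt (by simp)
    have hf : ∀ v, MDifferentiableAt (𝓡 d) 𝓘(ℝ, V) f.1 v := fun v =>
      (f.2.1 v).mdifferentiableAt (by simp)
    have e1 : f.1 ∘ (fun v => L.bundle.act v g) =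
        (LinearMap.toContinuousLinearMap ((ρ g⁻¹).restrictScalars ℝ)) ∘ f.1 := by
      funext v
      exact f.2.2 v g
    have h1 := mfderiv_comp u (hf (L.bundle.act u g)) hR
    have h2 := mfderiv_comp u
      ((LinearMap.toContinuousLinearMap ((ρ g⁻¹).restrictScalars ℝ)).differentiableAt.mdifferentiableAt
        (x := f.1 u)) (hf u)
    rw [e1, h2] at h1
    have h3 := congrArg (fun T => T (ξ₀ u)) h1
    have h4 : mfderiv 𝓘(ℝ, V) 𝓘(ℝ, V)
        (LinearMap.toContinuousLinearMap ((ρ g⁻¹).restrictScalars ℝ)) (f.1 u) =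
          LinearMap.toContinuousLinearMap ((ρ g⁻¹).restrictScalars ℝ) := by
      rw [mfderiv_eq_fderiv, ContinuousLinearMap.fderiv]
    rw [h4] at h3
    simp only [dirDeriv]
    rw [← hξ.invariant u g]
    exact h3.symm

/-- The Lie derivative `𝓛_ξ` on sections of an associated bundle: the derivative of the
corresponding equivariant functions along the lift `ξ₀` of `ξ`. -/
noncomputable def IsInfinitesimalSymmetry.lieDerivative (hξ : IsInfinitesimalSymmetry L ξ ξ₀)
    (s : AssocSection L.bundle ρ) : AssocSection L.bundle ρ :=
  AssocSection.ofFun ⟨_, hξ.dirDeriv_mem (AssocSection.equivFun s)⟩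

end Symmetry

/-! ### Representations -/

/-- A finite dimensional complex representation of the Lie group `G̃₀ = GL⁺(2, ℝ) × Spin(n)` on
which the central element `-1 ∈ Spin(n)` acts as `-id`. -/
structure SpinorRep (n : ℕ) (V : Type*) [NormedAddCommGroup V] [NormedSpace ℂ V] where
  toHom : G0Tilde n →* (V →ₗ[ℂ] V)
  smooth : ∀ (k : ℕ) (Ω : Set (EuclideanSpace ℝ (Fin k))), IsOpen Ω →
    ∀ g : EuclideanSpace ℝ (Fin k) → G0Tilde n, SmoothIntoOn g Ω →
      ∀ v : V, ContDiffOn ℝ ∞ (fun y => toHom (g y) v) Ω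
  neg_one : ∀ a : Spin n, (a : Cl n) = -1 → toHom (1, a) = -1

namespace SpinorRep

variable {n : ℕ} {V : Type*} [NormedAddCommGroup V] [NormedSpace ℂ V] (ρ : SpinorRep n V)

/-- The representation `⟨z, a⟩ ↦ z ρ(1, a)` of `Spinᶜ(n)`. -/
noncomputable def spinCHom : SpinC n →* (V →ₗ[ℂ] V) :=
  QuotientGroup.lift (spinCKernel n)
    { toFun := fun p => (p.1 : ℂ) • ρ.toHom (1, p.2)
      map_one' := by
        rw [Prod.fst_one, Prod.snd_one, Circle.coe_one, one_smul]
        exact map_one ρ.toHom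
      map_mul' := fun p q => by
        rw [Prod.fst_mul, Prod.snd_mul, Circle.coe_mul, smul_mul_smul_comm, ← map_mul,
          Prod.mk_mul_mk, one_mul] }
    (by
      rintro ⟨z, a⟩ (⟨h1, h2⟩ | ⟨h1, h2⟩)
      · have ha : a = 1 := Subtype.ext h2
        change (z : ℂ) • ρ.toHom (1, a) = 1
        rw [ha, show z = 1 from h1, Circle.coe_one, one_smul]
        exact map_one ρ.toHom
      · change (z : ℂ) • ρ.toHom (1, a) = 1
        rw [ρ.neg_one a h2, show z = -1 from h1]
        simp)

/-- The associated representation `(A, ⟨z, a⟩) ↦ z ρ(A, a)` of `G₀ᶜ`. -/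
noncomputable def extend : G0C n →* (V →ₗ[ℂ] V) where
  toFun g := ρ.toHom (g.1, 1) * ρ.spinCHom g.2
  map_one' := by
    rw [Prod.fst_one, Prod.snd_one, map_one, mul_one]
    exact map_one ρ.toHom
  map_mul' := by
    rintro ⟨A, c⟩ ⟨A', c'⟩
    have hc : ρ.spinCHom c * ρ.toHom (A', 1) = ρ.toHom (A', 1) * ρ.spinCHom c := by
      obtain ⟨⟨z, a⟩, rfl⟩ := QuotientGroup.mk_surjective c
      change ((z : ℂ) • ρ.toHom (1, a)) * _ = _ * ((z : ℂ) • ρ.toHom (1, a))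
      rw [smul_mul_assoc, mul_smul_comm, ← map_mul, ← map_mul]
      simp
    have hA : ρ.toHom (A * A', 1) = ρ.toHom (A, 1) * ρ.toHom (A', 1) := by
      rw [← map_mul, Prod.mk_mul_mk, one_mul]
    change ρ.toHom (A * A', 1) * ρ.spinCHom (c * c') = _
    rw [hA, map_mul, mul_assoc, mul_assoc, ← mul_assoc _ _ (ρ.spinCHom c'), ← hc, mul_assoc]

theorem extend_apply (A : GL2Plus) (z : Circle) (a : Spin n) :
    ρ.extend (A, SpinC.mk z a) = (z : ℂ) • ρ.toHom (A, a) := by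
  change ρ.toHom (A, 1) * ((z : ℂ) • ρ.toHom (1, a)) = _
  rw [mul_smul_comm, ← map_mul, Prod.mk_mul_mk, one_mul, mul_one]

end SpinorRep

/-! ### Natural operators -/

/-- A morphism of Lie contact structures: a homomorphism `F` of principal `G̃₀`-bundles that covers
a local diffeomorphism `f` and is compatible with the frames (so it pulls the tautological forms
back to each other). -/
structure IsLieContactMorphism {n d₁ d₂ : ℕ}
    {P₁ : Type*} [TopologicalSpace P₁] [ChartedSpace (EuclideanSpace ℝ (Fin d₁)) P₁]
    {N₁ : Type*} [TopologicalSpace N₁] [ChartedSpace (EuclideanSpace ℝ (Fin (2 * n + 1))) N₁]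
    [IsManifold (𝓡 (2 * n + 1)) ∞ N₁]
    {P₂ : Type*} [TopologicalSpace P₂] [ChartedSpace (EuclideanSpace ℝ (Fin d₂)) P₂]
    {N₂ : Type*} [TopologicalSpace N₂] [ChartedSpace (EuclideanSpace ℝ (Fin (2 * n + 1))) N₂]
    [IsManifold (𝓡 (2 * n + 1)) ∞ N₂]
    (L₁ : LieContactStructure n d₁ P₁ N₁) (L₂ : LieContactStructure n d₂ P₂ N₂)
    (F : P₁ → P₂) (f : N₁ → N₂) : Prop where
  smooth : ContMDiff (𝓡 d₁) (𝓡 d₂) ∞ F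
  localDiffeo : IsLocalDiffeomorph (𝓡 (2 * n + 1)) (𝓡 (2 * n + 1)) ∞ f
  proj_comp : ∀ u, L₂.bundle.proj (F u) = f (L₁.bundle.proj u)
  equivariant : ∀ u g, F (L₁.bundle.act u g) = L₂.bundle.act (F u) g
  frame : ∀ u X,
    tangentMap (𝓡 (2 * n + 1)) (𝓡 (2 * n + 1)) f ⟨L₁.bundle.proj u, L₁.frame u X⟩ =
      ⟨L₂.bundle.proj (F u), L₂.frame (F u) X⟩

/-- A linear differential operator, between bundles associated to representations of `G̃₀`, that is
natural for Lie contact structures of type `(G̃, P̃)`: a linear differential operator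
`Γ(V) → Γ(W)` for each manifold with a Lie contact structure, compatible with the pullback of sections
along all morphisms. The section `s₁` is the pullback of `s₂` along `F` if and only if its equivariant
function is the composite of that of `s₂` with `F`. -/
structure NaturalOperator (n : ℕ) {V W : Type*} [NormedAddCommGroup V] [NormedSpace ℂ V]
    [NormedAddCommGroup W] [NormedSpace ℂ W] (ρ : SpinorRep n V) (ϑ : SpinorRep n W) where
  op : ∀ {d : ℕ} {P : Type u} [TopologicalSpace P] [ChartedSpace (EuclideanSpace ℝ (Fin d)) P]
    [IsManifold (𝓡 d) ∞ P] [T2Space P] [SecondCountableTopology P]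
    {N : Type u} [TopologicalSpace N] [ChartedSpace (EuclideanSpace ℝ (Fin (2 * n + 1))) N]
    [IsManifold (𝓡 (2 * n + 1)) ∞ N] [T2Space N] [SecondCountableTopology N]
    (L : LieContactStructure n d P N),
    AssocSection L.bundle ρ.toHom →ₗ[ℂ] AssocSection L.bundle ϑ.toHom
  isDifferentialOperator : ∀ {d : ℕ}
    {P : Type u} [TopologicalSpace P] [ChartedSpace (EuclideanSpace ℝ (Fin d)) P]
    [IsManifold (𝓡 d) ∞ P] [T2Space P] [SecondCountableTopology P]
    {N : Type u} [TopologicalSpace N] [ChartedSpace (EuclideanSpace ℝ (Fin (2 * n + 1))) N]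
    [IsManifold (𝓡 (2 * n + 1)) ∞ N] [T2Space N] [SecondCountableTopology N]
    (L : LieContactStructure n d P N), IsDifferentialOperator (op L)
  natural : ∀ {d₁ d₂ : ℕ}
    {P₁ : Type u} [TopologicalSpace P₁] [ChartedSpace (EuclideanSpace ℝ (Fin d₁)) P₁]
    [IsManifold (𝓡 d₁) ∞ P₁] [T2Space P₁] [SecondCountableTopology P₁]
    {N₁ : Type u} [TopologicalSpace N₁] [ChartedSpace (EuclideanSpace ℝ (Fin (2 * n + 1))) N₁]
    [IsManifold (𝓡 (2 * n + 1)) ∞ N₁] [T2Space N₁] [SecondCountableTopology N₁]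
    {P₂ : Type u} [TopologicalSpace P₂] [ChartedSpace (EuclideanSpace ℝ (Fin d₂)) P₂]
    [IsManifold (𝓡 d₂) ∞ P₂] [T2Space P₂] [SecondCountableTopology P₂]
    {N₂ : Type u} [TopologicalSpace N₂] [ChartedSpace (EuclideanSpace ℝ (Fin (2 * n + 1))) N₂]
    [IsManifold (𝓡 (2 * n + 1)) ∞ N₂] [T2Space N₂] [SecondCountableTopology N₂]
    (L₁ : LieContactStructure n d₁ P₁ N₁) (L₂ : LieContactStructure n d₂ P₂ N₂)
    (F : P₁ → P₂) (f : N₁ → N₂), IsLieContactMorphism L₁ L₂ F f →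
    ∀ (s₁ : AssocSection L₁.bundle ρ.toHom) (s₂ : AssocSection L₂.bundle ρ.toHom),
      (∀ u, s₁.frameFun u = s₂.frameFun (F u)) →
        ∀ u, (op L₁ s₁).frameFun u = (op L₂ s₂).frameFun (F u)

/-! ### The determinant circle bundle and the Lie contact structure on it -/

section Descent

variable {n e d : ℕ} {Q : Type*} [TopologicalSpace Q] [ChartedSpace (EuclideanSpace ℝ (Fin e)) Q]
  {M : Type*} [TopologicalSpace M] [ChartedSpace (EuclideanSpace ℝ (Fin (2 * n))) M]
  [IsManifold (𝓡 (2 * n)) ∞ M]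
  {P : Type*} [TopologicalSpace P] [ChartedSpace (EuclideanSpace ℝ (Fin d)) P]
  [IsManifold (𝓡 d) ∞ P]
  {N : Type*} [TopologicalSpace N] [ChartedSpace (EuclideanSpace ℝ (Fin (2 * n + 1))) N]
  [IsManifold (𝓡 (2 * n + 1)) ∞ N]

/-- `r : P → 𝒢₀` makes the `G₀ᶜ`-bundle `P → M` a lift of the `G₀`-bundle `𝒢₀ → M`. -/
structure IsLift (S : G0Structure n e Q M) (B : PrincipalBundle (G0C n) d (2 * n) P M)
    (r : P → Q) : Prop where
  smooth : ContMDiff (𝓡 d) (𝓡 e) ∞ r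
  proj_comp : ∀ u, S.bundle.proj (r u) = B.proj u
  equivariant : ∀ u g, r (B.act u g) = S.bundle.act (r u) g.toG0

/-- The `U(1)`-bundle `N → M` is the determinant circle bundle `P ×_{G₀ᶜ} U(1)` of `P → M`, where
`G₀ᶜ` acts on `U(1)` through `ςₙ`, and `π(u) = [u, 1]`. (The map `[u, z] ↦ π(u) z` is an isomorphism
of `U(1)`-bundles from `P ×_{G₀ᶜ} U(1)` to `N` for any `π` with these properties.) -/
structure IsDeterminantCircleBundle (B : PrincipalBundle (G0C n) d (2 * n) P M)
    (C : PrincipalBundle Circle (2 * n + 1) (2 * n) N M) (π : P → N) : Prop where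
  smooth : ContMDiff (𝓡 d) (𝓡 (2 * n + 1)) ∞ π
  proj_comp : ∀ u, C.proj (π u) = B.proj u
  equivariant : ∀ u g, π (B.act u g) = C.act (π u) (spinCDet n g.2)

/-- `iα` is a principal connection on the `U(1)`-bundle `N → M`: `α` is an invariant 1-form that is
`1` on the fundamental vector field of `i ∈ 𝔲(1)`, the velocity of `t ↦ x exp(it)`. -/
structure IsPrincipalConnection (C : PrincipalBundle Circle (2 * n + 1) (2 * n) N M)
    (α : ∀ x : N, TangentSpace (𝓡 (2 * n + 1)) x →ₗ[ℝ] ℝ) : Prop where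
  smooth : IsSmoothOneForm α
  vertical : ∀ x, α (C.act x (Circle.exp 0))
    (mfderiv 𝓘(ℝ, ℝ) (𝓡 (2 * n + 1)) (fun t : ℝ => C.act x (Circle.exp t)) 0 (1 : ℝ)) = 1
  invariant : ∀ (x : N) (z : Circle) (v : TangentSpace (𝓡 (2 * n + 1)) x),
    α (C.act x z) (mfderiv (𝓡 (2 * n + 1)) (𝓡 (2 * n + 1)) (fun y => C.act y z) x v) = α x v

/-- `iα` is a compatible principal connection: `dα` is the pullback of a closed (equivalently, of a
parallel) global section `Ω` of `ℓ`. -/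
structure IsCompatibleConnection (S : G0Structure n e Q M)
    (C : PrincipalBundle Circle (2 * n + 1) (2 * n) N M)
    (α : ∀ x : N, TangentSpace (𝓡 (2 * n + 1)) x →ₗ[ℝ] ℝ) : Prop where
  isPrincipalConnection : IsPrincipalConnection C α
  curvature :
    ∃ Ω : ∀ x : M, TangentSpace (𝓡 (2 * n)) x →ₗ[ℝ] TangentSpace (𝓡 (2 * n)) x →ₗ[ℝ] ℝ,
      IsClosedSection S Set.univ Ω ∧
        ∀ X Y : ∀ x : N, TangentSpace (𝓡 (2 * n + 1)) x,
          IsSmoothVectorField X → IsSmoothVectorField Y → ∀ x,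
            extDerivOne α X Y x =
              Ω (C.proj x) (mfderiv (𝓡 (2 * n + 1)) (𝓡 (2 * n)) C.proj x (X x))
                (mfderiv (𝓡 (2 * n + 1)) (𝓡 (2 * n)) C.proj x (Y x))

/-- `ξ` is the Reeb field of `α`: `α(ξ) = 1` and `dα(ξ, ·) = 0`. -/
structure IsReebField (α : ∀ x : N, TangentSpace (𝓡 (2 * n + 1)) x →ₗ[ℝ] ℝ)
    (ξ : ∀ x : N, TangentSpace (𝓡 (2 * n + 1)) x) : Prop where
  normalized : ∀ x, α x (ξ x) = 1
  kernel : ∀ Y : ∀ x : N, TangentSpace (𝓡 (2 * n + 1)) x, IsSmoothVectorField Y →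
    ∀ x, extDerivOne α ξ Y x = 0

/-- The homomorphism `q₀ : P / {±1} → 𝒢₀` of `G₀`-bundles that is induced by the lift `r : P → 𝒢₀` is
a PCS-quotient by the infinitesimal symmetry with lift `ξ₀` to `P`: it is surjective with connected
fibres (those of `r` are double covers of them by the action of `-1`, which is in the circle
subgroup of `Spinᶜ(n)` that acts along the fibres of `r`), the kernel of its tangent map is spanned by
the lift of the symmetry, and `θ₋₁` is the restriction of the pullback of `θ` to the vectors that
project into `H`. -/
structure IsPCSQuotient (S : G0Structure n e Q M) (L : LieContactStructure n d P N)
    (ξ₀ : ∀ u : P, TangentSpace (𝓡 d) u) (r : P → Q) : Prop where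
  surjective : Function.Surjective r
  connected : ∀ w : Q, IsConnected (r ⁻¹' {w})
  kernel : ∀ (u : P) (v : TangentSpace (𝓡 d) u),
    mfderiv (𝓡 d) (𝓡 e) r u v = 0 ↔ v ∈ Submodule.span ℝ {ξ₀ u}
  soldering : ∀ (u : P) (v : TangentSpace (𝓡 d) u) (X : GMinusOne n),
    mfderiv (𝓡 d) (𝓡 (2 * n + 1)) L.bundle.proj u v = L.frame u X →
      mfderiv (𝓡 e) (𝓡 (2 * n)) S.bundle.proj (r u) (mfderiv (𝓡 d) (𝓡 e) r u v) =
        S.frame (r u) X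

/-- `L` is the Lie contact structure of type `(G̃, P̃)` on the determinant circle bundle: its
principal bundle is `π : P → N` with the restricted action of `G̃₀`, its contact distribution is the
kernel of `α`, the Reeb field `ξ` of `α` is a transversal infinitesimal symmetry with lift `ξ₀` to `P`,
and the lift `r : P → 𝒢₀` induces a PCS-quotient by `ξ`. -/
structure IsInducedLieContactStructure (S : G0Structure n e Q M)
    (B : PrincipalBundle (G0C n) d (2 * n) P M) (r : P → Q) (π : P → N)
    (α : ∀ x : N, TangentSpace (𝓡 (2 * n + 1)) x →ₗ[ℝ] ℝ)
    (L : LieContactStructure n d P N) (ξ : ∀ x : N, TangentSpace (𝓡 (2 * n + 1)) x)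
    (ξ₀ : ∀ u : P, TangentSpace (𝓡 d) u) : Prop where
  proj_eq : L.bundle.proj = π
  act_eq : ∀ u g, L.bundle.act u g = B.act u g.toG0C
  contact : ∀ x, L.H x = LinearMap.ker (α x)
  reeb : IsReebField α ξ
  symmetry : IsInfinitesimalSymmetry L ξ ξ₀
  transversal : ∀ x, ξ x ∉ L.H x
  quotient : IsPCSQuotient S L ξ₀ r

variable {B : PrincipalBundle (G0C n) d (2 * n) P M} {L : LieContactStructure n d P N}

/-- `φ` sends a section `s` of `P ×_{G₀ᶜ} V → M` to the section of `P ×_{G̃₀} V → N` that is `[u, v]` at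
the base point of `u` in `N`, where `[u, v]` is the value of `s` at the base point of `u` in `M`. -/
def IsCanonicalMap {V : Type*} [NormedAddCommGroup V] [NormedSpace ℂ V] {ρ : SpinorRep n V}
    (φ : AssocSection B ρ.extend →ₗ[ℂ] AssocSection L.bundle ρ.toHom) : Prop :=
  ∀ s u v, s.toFun (B.proj u) = Assoc.mk B ρ.extend u v →
    (φ s).toFun (L.bundle.proj u) = Assoc.mk L.bundle ρ.toHom u v

end Descent

end LieContact

open LieContact

/-!
Sections of `P ×_{G₀ᶜ} V → M` and of `P ×_{G̃₀} V → N` are both smooth functions `P → V` on the same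
total space `P`, equivariant for `G₀ᶜ` and for its subgroup `G̃₀` respectively. Since `G₀ᶜ` is
generated by `G̃₀` and the central circle `{⟨z, 1⟩}`, on which the extended representation is
multiplication by `z`, the map `φ` is the inclusion of the functions `f` that satisfy in addition
`f(u⟨z, 1⟩) = z⁻¹ f(u)`.

The lift `ξ₀` of the Reeb field is the generator of the action of this circle, parametrized as
`⟨exp(it/2), 1⟩` (`IsInducedLieContactStructure.velocity`): the orbits lie in the fibres of
`P → 𝒢₀`, whose tangent spaces are spanned by `ξ₀`, and they cover the orbits of `t ↦ exp(it)` in `N`,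
so that the connection form fixes the factor. The extra condition on `f` is therefore equivalent to
the linear differential equation `ξ₀ f = -(i/2) f` along the orbits
(`IsInducedLieContactStructure.dirDeriv_eq_iff`), which describes the range of `φ`.

The central circle acts on `P` by automorphisms of the Lie contact structure
(`IsInducedLieContactStructure.isLieContactMorphism_centralCircle`), because its elements commute
with `G̃₀`, preserve `ker α` and cover the identity of `𝒢₀`, from which the partial form is pulled
back. A natural operator commutes with these automorphisms and is linear over `ℂ`, so it preserves
the condition `f(u⟨z, 1⟩) = z⁻¹ f(u)` and restricts to the range of `φ`. The restriction has the
same order, since a section and its image under `φ` have the same function on `P`.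
-/

namespace LieContact

/-! ### Curves and projections in principal bundles -/

namespace PrincipalBundle

variable {G : Type*} [Group G] [SmoothCoords G] {d m : ℕ}
  {P : Type*} [TopologicalSpace P] [ChartedSpace (EuclideanSpace ℝ (Fin d)) P]
  {M : Type*} [TopologicalSpace M] [ChartedSpace (EuclideanSpace ℝ (Fin m)) M]
  (B : PrincipalBundle G d m P M)

theorem contMDiff_act_curve (u : P) (g : ℝ → G)
    (hg : ∀ c ∈ SmoothCoords.coords (G := G), ContDiff ℝ ∞ (fun t => c (g t))) :
    ContMDiff 𝓘(ℝ, ℝ) (𝓡 d) ∞ (fun t => B.act u (g t)) := by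
  have hp : ContDiff ℝ ∞ (fun y : EuclideanSpace ℝ (Fin 1) => y 0) := by fun_prop
  have h := B.smooth_act 1 Set.univ isOpen_univ (fun _ => u) (fun y => g (y 0))
    contMDiffOn_const (fun c hc => ((hg c hc).comp hp).contDiffOn)
  rw [contMDiffOn_univ] at h
  have hi : ContDiff ℝ ∞ (fun t : ℝ => (!₂[t] : EuclideanSpace ℝ (Fin 1))) := by
    rw [contDiff_euclidean]
    intro i
    fin_cases i
    exact contDiff_id (𝕜 := ℝ) (E := ℝ)
  exact h.comp hi.contMDiff

theorem proj_act (u : P) (g : G) : B.proj (B.act u g) = B.proj u :=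
  ((B.proj_eq_iff _ _).2 ⟨g, rfl⟩).symm

/-- The projection of a principal bundle is a submersion: every point lies on a smooth local
section, obtained from any given one by translation with a group element. -/
theorem surjective_mfderiv_proj [IsManifold (𝓡 d) ∞ P] (u : P) :
    Function.Surjective (mfderiv (𝓡 d) (𝓡 m) B.proj u) := by
  obtain ⟨U, σ, hU, hu, hσ, hσ'⟩ := B.exists_section (B.proj u)
  obtain ⟨g, hg⟩ := (B.proj_eq_iff (σ (B.proj u)) u).1 (hσ' _ hu)
  have hτ : MDifferentiableAt (𝓡 m) (𝓡 d) (fun x => B.act (σ x) g) (B.proj u) :=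
    (((B.smooth_act_right g).mdifferentiable (by simp)) _).comp (B.proj u)
      ((hσ.contMDiffAt (hU.mem_nhds hu)).mdifferentiableAt (by simp))
  have hτu : B.act (σ (B.proj u)) g = u := hg.symm
  have hp : MDifferentiableAt (𝓡 d) (𝓡 m) B.proj (B.act (σ (B.proj u)) g) :=
    B.smooth_proj.mdifferentiable (by simp) _
  have hc := mfderiv_comp (B.proj u) hp hτ
  have he : B.proj ∘ (fun x => B.act (σ x) g) =ᶠ[nhds (B.proj u)] id := by
    filter_upwards [hU.mem_nhds hu] with x hx
    simp only [Function.comp_apply, id_eq, B.proj_act, hσ' x hx]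
  rw [he.mfderiv_eq, mfderiv_id, hτu] at hc
  intro w
  exact ⟨mfderiv (𝓡 m) (𝓡 d) (fun x => B.act (σ x) g) (B.proj u) w,
    (congrArg (fun T => T w) hc).symm⟩

end PrincipalBundle

/-! ### Linear operations on sections -/

namespace AssocSection

variable {G : Type*} [Group G] [SmoothCoords G] {d m : ℕ}
  {P : Type*} [TopologicalSpace P] [ChartedSpace (EuclideanSpace ℝ (Fin d)) P]
  {M : Type*} [TopologicalSpace M] [ChartedSpace (EuclideanSpace ℝ (Fin m)) M]
  {B : PrincipalBundle G d m P M}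
  {V : Type*} [NormedAddCommGroup V] [NormedSpace ℂ V] {ρ : G →* (V →ₗ[ℂ] V)}

theorem frameFun_add (s t : AssocSection B ρ) : (s + t).frameFun = s.frameFun + t.frameFun :=
  frameFun_ofFun (equivFun s + equivFun t)

theorem frameFun_smul (c : ℂ) (s : AssocSection B ρ) : (c • s).frameFun = c • s.frameFun :=
  frameFun_ofFun (c • equivFun s)

theorem frameFun_zero : (0 : AssocSection B ρ).frameFun = 0 :=
  frameFun_ofFun (0 : EquivariantFun B ρ)

theorem toFun_proj_eq_zero_iff (s : AssocSection B ρ) (u : P) :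
    s.toFun (B.proj u) = (0 : AssocSection B ρ).toFun (B.proj u) ↔ s.frameFun u = 0 := by
  rw [toFun_proj, toFun_proj, frameFun_zero]
  exact (Assoc.mk_injective B ρ u).eq_iff

end AssocSection

/-! ### The central circle of the structure group -/

/-- The element `(1, ⟨z, 1⟩)` of the central circle of `G₀ᶜ`. -/
noncomputable def centralCircle (n : ℕ) (z : Circle) : G0C n := (1, SpinC.mk z 1)

theorem centralCircle_mul {n : ℕ} (z w : Circle) :
    centralCircle n (z * w) = centralCircle n z * centralCircle n w := by
  refine Prod.ext (one_mul 1).symm ?_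
  change (QuotientGroup.mk (z * w, 1) : SpinC n) = QuotientGroup.mk ((z, 1) * (w, 1))
  rw [Prod.mk_mul_mk, one_mul]

theorem centralCircle_one {n : ℕ} : centralCircle n 1 = 1 := rfl

theorem G0Tilde.toG0C_mul_centralCircle {n : ℕ} (g : G0Tilde n) (z : Circle) :
    g.toG0C * centralCircle n z = (g.1, SpinC.mk z g.2) := by
  refine Prod.ext (mul_one _) ?_
  change (QuotientGroup.mk ((1, g.2) * (z, 1)) : SpinC n) = QuotientGroup.mk (z, g.2)
  rw [Prod.mk_mul_mk, one_mul, mul_one]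

theorem G0Tilde.centralCircle_mul_toG0C {n : ℕ} (g : G0Tilde n) (z : Circle) :
    centralCircle n z * g.toG0C = (g.1, SpinC.mk z g.2) := by
  refine Prod.ext (one_mul _) ?_
  change (QuotientGroup.mk ((z, 1) * (1, g.2)) : SpinC n) = QuotientGroup.mk (z, g.2)
  rw [Prod.mk_mul_mk, one_mul, mul_one]

theorem exists_toG0C_mul_centralCircle {n : ℕ} (g : G0C n) :
    ∃ (h : G0Tilde n) (z : Circle), g = h.toG0C * centralCircle n z := by
  obtain ⟨A, c⟩ := g
  obtain ⟨⟨z, a⟩, rfl⟩ := QuotientGroup.mk_surjective c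
  exact ⟨(A, a), z, (G0Tilde.toG0C_mul_centralCircle (A, a) z).symm⟩

theorem toG0_centralCircle {n : ℕ} (z : Circle) : (centralCircle n z).toG0 = 1 :=
  Prod.ext rfl (map_one (spinToSO n))

theorem spinCDet_centralCircle {n : ℕ} (z : Circle) :
    spinCDet n (centralCircle n z).2 = z ^ 2 := rfl

theorem contDiff_coords_centralCircle_exp {n : ℕ} (c : G0C n → ℝ)
    (hc : c ∈ SmoothCoords.coords (G := G0C n)) :
    ContDiff ℝ ∞ (fun t : ℝ => c (centralCircle n (Circle.exp (t / 2)))) := by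
  rcases hc with ⟨b, _, rfl⟩ | ⟨b, ⟨l, hl⟩, rfl⟩
  · change ContDiff ℝ ∞ (fun _ : ℝ => b 1)
    exact contDiff_const
  · let T : ℂ →L[ℝ] ℝ := LinearMap.toContinuousLinearMap
      (l ∘ₗ (TensorProduct.mk ℝ ℂ (Cl n)).flip ((1 : Spin n) : Cl n))
    have h : (fun t : ℝ => b (SpinC.mk (Circle.exp (t / 2)) (1 : Spin n))) = fun t : ℝ =>
        T (Complex.exp ((t / 2 : ℝ) * Complex.I)) := by
      funext t
      rw [hl, Circle.coe_exp]
      rfl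
    change ContDiff ℝ ∞ (fun t : ℝ => b (SpinC.mk (Circle.exp (t / 2)) (1 : Spin n)))
    rw [h]
    have he : ContDiff ℝ ∞ (fun t : ℝ => Complex.exp ((t / 2 : ℝ) * Complex.I)) :=
      ((Complex.ofRealCLM.contDiff.comp
        ((contDiff_id (𝕜 := ℝ) (E := ℝ)).div_const 2)).mul contDiff_const).cexp
    exact T.contDiff.comp he

theorem contDiff_coords_circle_exp (c : Circle → ℝ)
    (hc : c ∈ SmoothCoords.coords (G := Circle)) :
    ContDiff ℝ ∞ (fun t : ℝ => c (Circle.exp t)) := by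
  have h : ContDiff ℝ ∞ (fun t : ℝ => (Circle.exp t : ℂ)) := by
    simp only [Circle.coe_exp]
    exact (Complex.ofRealCLM.contDiff.mul contDiff_const).cexp
  rcases hc with rfl | rfl
  · exact Complex.reCLM.contDiff.comp h
  · exact Complex.imCLM.contDiff.comp h

namespace SpinorRep

variable {n : ℕ} {V : Type*} [NormedAddCommGroup V] [NormedSpace ℂ V] (ρ : SpinorRep n V)

theorem extend_toG0C (g : G0Tilde n) : ρ.extend g.toG0C = ρ.toHom g := by
  rw [G0Tilde.toG0C, extend_apply, Circle.coe_one, one_smul]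

theorem extend_centralCircle (z : Circle) (v : V) :
    ρ.extend (centralCircle n z) v = (z : ℂ) • v := by
  rw [centralCircle, extend_apply]
  change (z : ℂ) • ρ.toHom 1 v = _
  rw [map_one, Module.End.one_apply]

end SpinorRep

/-! ### The lift of the Reeb field generates the central circle -/

variable {n e d : ℕ} {Q : Type*} [TopologicalSpace Q] [ChartedSpace (EuclideanSpace ℝ (Fin e)) Q]
  {M : Type*} [TopologicalSpace M] [ChartedSpace (EuclideanSpace ℝ (Fin (2 * n))) M]
  {P : Type*} [TopologicalSpace P] [ChartedSpace (EuclideanSpace ℝ (Fin d)) P]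
  {N : Type*} [TopologicalSpace N] [ChartedSpace (EuclideanSpace ℝ (Fin (2 * n + 1))) N]
  {B : PrincipalBundle (G0C n) d (2 * n) P M} {r : P → Q}
  {C : PrincipalBundle Circle (2 * n + 1) (2 * n) N M} {π : P → N}

theorem IsDeterminantCircleBundle.act_centralCircle (hC : IsDeterminantCircleBundle B C π)
    (u : P) (z : Circle) : π (B.act u (centralCircle n z)) = C.act (π u) (z ^ 2) := by
  rw [hC.equivariant, spinCDet_centralCircle]

theorem mdifferentiable_act_centralCircle (B : PrincipalBundle (G0C n) d (2 * n) P M) (u : P) :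
    MDifferentiable 𝓘(ℝ, ℝ) (𝓡 d)
      (fun t : ℝ => B.act u (centralCircle n (Circle.exp (t / 2)))) :=
  (B.contMDiff_act_curve u _ contDiff_coords_centralCircle_exp).mdifferentiable (by simp)

variable [IsManifold (𝓡 (2 * n + 1)) ∞ N]
  {α : ∀ x : N, TangentSpace (𝓡 (2 * n + 1)) x →ₗ[ℝ] ℝ}

/-- `α` takes the value `1` on the velocity of the curve `t ↦ x exp(it)` at each time. -/
theorem IsPrincipalConnection.apply_velocity (hα : IsPrincipalConnection C α) (x : N) (t : ℝ) :
    α (C.act x (Circle.exp t))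
      (mfderiv 𝓘(ℝ, ℝ) (𝓡 (2 * n + 1)) (fun s : ℝ => C.act x (Circle.exp s)) t (1 : ℝ)) = 1 := by
  have hsmooth := C.contMDiff_act_curve (C.act x (Circle.exp t)) _ contDiff_coords_circle_exp
  have hcurve : (fun s : ℝ => C.act x (Circle.exp s)) =
      (fun s : ℝ => C.act (C.act x (Circle.exp t)) (Circle.exp s)) ∘ fun s => s - t := by
    funext s
    rw [Function.comp_apply, ← C.act_mul, ← Circle.exp_add, add_sub_cancel]
  have hd : HasMFDerivAt 𝓘(ℝ, ℝ) 𝓘(ℝ, ℝ) (fun s : ℝ => s - t) t (ContinuousLinearMap.id ℝ ℝ) :=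
    ((hasFDerivAt_id t).sub_const t).hasMFDerivAt
  have hv : mfderiv 𝓘(ℝ, ℝ) (𝓡 (2 * n + 1)) (fun s : ℝ => C.act x (Circle.exp s)) t =
      mfderiv 𝓘(ℝ, ℝ) (𝓡 (2 * n + 1))
        (fun s : ℝ => C.act (C.act x (Circle.exp t)) (Circle.exp s)) 0 := by
    have h := (HasMFDerivAt.comp (f := fun s : ℝ => s - t) t
      (hsmooth.mdifferentiable (by simp) (t - t)).hasMFDerivAt hd).mfderiv
    rw [← hcurve, sub_self] at h
    exact h.trans (ContinuousLinearMap.comp_id _)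
  -- for `y = x exp(it)` the base points `y exp(0)` and `y` are equal only propositionally
  have key : ∀ y, y = C.act x (Circle.exp t) → ∀ v : EuclideanSpace ℝ (Fin (2 * n + 1)),
      α y v = α (C.act x (Circle.exp t)) v := by
    rintro y rfl v
    rfl
  have h1 := hα.vertical (C.act x (Circle.exp t))
  rw [← hv] at h1
  exact (key _ (by rw [Circle.exp_zero, C.act_one]) _).symm.trans h1

variable [IsManifold (𝓡 (2 * n)) ∞ M] {S : G0Structure n e Q M}

theorem IsLift.act_centralCircle (hr : IsLift S B r) (u : P) (z : Circle) :
    r (B.act u (centralCircle n z)) = r u := by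
  rw [hr.equivariant, toG0_centralCircle, S.bundle.act_one]

variable [IsManifold (𝓡 d) ∞ P]
  {L : LieContactStructure n d P N} {ξ : ∀ x : N, TangentSpace (𝓡 (2 * n + 1)) x}
  {ξ₀ : ∀ u : P, TangentSpace (𝓡 d) u}

namespace IsInducedLieContactStructure

/-- The curve `t ↦ u ⟨exp(it/2), 1⟩` is an integral curve of the lift `ξ₀` of the Reeb field. It lies
in a fibre of `r`, so its velocity is a multiple of `ξ₀`; it covers `t ↦ π(u) exp(it)`, as
`ςₙ⟨z, 1⟩ = z²`, so the multiple is `1` because `α` is `1` both on the fundamental field and on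
the Reeb field. -/
theorem velocity (hL : IsInducedLieContactStructure S B r π α L ξ ξ₀) (hr : IsLift S B r)
    (hC : IsDeterminantCircleBundle B C π) (hα : IsPrincipalConnection C α) (u : P) (t : ℝ) :
    mfderiv 𝓘(ℝ, ℝ) (𝓡 d) (fun t : ℝ => B.act u (centralCircle n (Circle.exp (t / 2)))) t (1 : ℝ)
      = ξ₀ (B.act u (centralCircle n (Circle.exp (t / 2)))) := by
  set γ : ℝ → P := fun t => B.act u (centralCircle n (Circle.exp (t / 2))) with hγ
  have hγd : MDifferentiableAt 𝓘(ℝ, ℝ) (𝓡 d) γ t := mdifferentiable_act_centralCircle B u t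
  have hrγ : r ∘ γ = fun _ => r u := funext fun s => hr.act_centralCircle u _
  have hvert : mfderiv (𝓡 d) (𝓡 e) r (γ t) (mfderiv 𝓘(ℝ, ℝ) (𝓡 d) γ t (1 : ℝ)) = 0 := by
    have h := mfderiv_comp t (hr.smooth.mdifferentiable (by simp) (γ t)) hγd
    rw [hrγ, mfderiv_const] at h
    exact (congrArg (fun T => T (1 : ℝ)) h).symm
  obtain ⟨a, ha⟩ := Submodule.mem_span_singleton.1 ((hL.quotient.kernel _ _).1 hvert)
  have hπγ : L.bundle.proj ∘ γ = fun s => C.act (π u) (Circle.exp s) := by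
    funext s
    rw [Function.comp_apply, hL.proj_eq, hγ, hC.act_centralCircle, pow_two, ← Circle.exp_add,
      add_halves]
  have hproj := mfderiv_comp t (L.bundle.smooth_proj.mdifferentiable (by simp) (γ t)) hγd
  have hproj1 : mfderiv 𝓘(ℝ, ℝ) (𝓡 (2 * n + 1)) (L.bundle.proj ∘ γ) t (1 : ℝ) =
      a • ξ (L.bundle.proj (γ t)) := by
    rw [hproj]
    change mfderiv (𝓡 d) (𝓡 (2 * n + 1)) L.bundle.proj (γ t)
      (mfderiv 𝓘(ℝ, ℝ) (𝓡 d) γ t (1 : ℝ)) = _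
    rw [← ha, map_smul, hL.symmetry.projects]
  have hone : ∀ c : ℝ → N, c = (fun s => C.act (π u) (Circle.exp s)) →
      α (c t) (mfderiv 𝓘(ℝ, ℝ) (𝓡 (2 * n + 1)) c t (1 : ℝ)) = 1 := by
    rintro c rfl
    exact hα.apply_velocity (π u) t
  have h1 := hone _ hπγ
  rw [hproj1] at h1
  have h2 : a * α (L.bundle.proj (γ t)) (ξ (L.bundle.proj (γ t))) = 1 :=
    (map_smul (α (L.bundle.proj (γ t))) a (ξ (L.bundle.proj (γ t)))).symm.trans h1
  rw [hL.reeb.normalized, mul_one] at h2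
  rw [← ha, h2, one_smul]

/-! ### Sections on the base as eigensections of the Lie derivative -/

section Sections

variable {V : Type*} [NormedAddCommGroup V] [NormedSpace ℂ V] (ρ : SpinorRep n V)

/-- The derivative of `f` along the orbits of the central circle is its derivative along `ξ₀`. -/
theorem hasDerivAt_comp_orbit (hL : IsInducedLieContactStructure S B r π α L ξ ξ₀)
    (hr : IsLift S B r) (hC : IsDeterminantCircleBundle B C π) (hα : IsPrincipalConnection C α)
    {f : P → V} (hf : ContMDiff (𝓡 d) 𝓘(ℝ, V) ∞ f) (u : P) (t : ℝ) :
    HasDerivAt (fun t : ℝ => f (B.act u (centralCircle n (Circle.exp (t / 2)))))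
      (dirDeriv f (B.act u (centralCircle n (Circle.exp (t / 2))))
        (ξ₀ (B.act u (centralCircle n (Circle.exp (t / 2)))))) t := by
  have h := HasMFDerivAt.comp t
    (hf.mdifferentiable (by simp) (B.act u (centralCircle n (Circle.exp (t / 2))))).hasMFDerivAt
    (mdifferentiable_act_centralCircle B u t).hasMFDerivAt
  have h2 : HasFDerivAt (𝕜 := ℝ) (E := ℝ) (F := V)
    (fun t : ℝ => f (B.act u (centralCircle n (Circle.exp (t / 2))))) _ t := h.hasFDerivAt
  rw [← hL.velocity hr hC hα u t]
  exact h2.hasDerivAt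

/-- A function has derivative `-(i/2)` times itself along `ξ₀` if and only if it is equivariant for
the action `⟨z, 1⟩ ↦ z` of the central circle: along orbits the condition is a linear differential
equation, solved by `exp(-it/2)`. -/
theorem dirDeriv_eq_iff (hL : IsInducedLieContactStructure S B r π α L ξ ξ₀)
    (hr : IsLift S B r) (hC : IsDeterminantCircleBundle B C π) (hα : IsPrincipalConnection C α)
    {f : P → V} (hf : ContMDiff (𝓡 d) 𝓘(ℝ, V) ∞ f) :
    (∀ u, dirDeriv f u (ξ₀ u) = (-(Complex.I / 2)) • f u) ↔
      ∀ u z, f (B.act u (centralCircle n z)) = ((z⁻¹ : Circle) : ℂ) • f u := by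
  have hexp : ∀ (k : ℂ) (t : ℝ), HasDerivAt (fun t : ℝ => Complex.exp (t * k))
      (k * Complex.exp (t * k)) t := fun k t => by
    simpa [mul_comm] using (((hasDerivAt_id t).ofReal_comp).mul_const k).cexp
  constructor
  · intro h u z
    -- the function is constant along the orbit after multiplication by `exp(it/2)`
    obtain ⟨θ, rfl⟩ : ∃ θ : ℝ, Circle.exp θ = z := ⟨_, Circle.exp_arg z⟩
    let c : ℝ → V := fun t => Complex.exp (t * (Complex.I / 2)) •
      f (B.act u (centralCircle n (Circle.exp (t / 2))))
    have hc : ∀ t, HasDerivAt c 0 t := fun t => by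
      have h1 := (hexp (Complex.I / 2) t).smul (hL.hasDerivAt_comp_orbit hr hC hα hf u t)
      rw [h, smul_smul, ← add_smul] at h1
      have h0 : Complex.exp (t * (Complex.I / 2)) * -(Complex.I / 2) +
          Complex.I / 2 * Complex.exp (t * (Complex.I / 2)) = 0 := by ring
      rw [h0, zero_smul] at h1
      exact h1
    have hcc := is_const_of_deriv_eq_zero (fun t => (hc t).differentiableAt)
      (fun t => (hc t).deriv) (2 * θ) 0
    simp only [c, Complex.ofReal_zero, zero_mul, Complex.exp_zero, one_smul, zero_div,
      Circle.exp_zero, centralCircle_one, B.act_one, mul_div_cancel_left₀ θ (two_ne_zero' ℝ)] at hcc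
    have he : ((2 * θ : ℝ) : ℂ) * (Complex.I / 2) = θ * Complex.I := by
      push_cast
      ring
    rw [he, ← Circle.coe_exp] at hcc
    rw [← hcc, smul_smul, ← Circle.coe_mul, inv_mul_cancel, Circle.coe_one, one_smul]
  · intro h u
    have h1 := hL.hasDerivAt_comp_orbit hr hC hα hf u 0
    have h2 : HasDerivAt (fun t : ℝ => f (B.act u (centralCircle n (Circle.exp (t / 2)))))
        ((-(Complex.I / 2)) • f u) 0 := by
      have h3 := (hexp (-(Complex.I / 2)) 0).smul_const (f u)
      rw [Complex.ofReal_zero, zero_mul, Complex.exp_zero, mul_one] at h3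
      convert h3 using 1
      funext t
      rw [h, ← Circle.exp_neg, Circle.coe_exp]
      congr 2
      push_cast
      ring
    have h3 := h1.unique h2
    rwa [zero_div, Circle.exp_zero, centralCircle_one, B.act_one] at h3

theorem equivariant_restrict (hL : IsInducedLieContactStructure S B r π α L ξ ξ₀)
    {f : P → V} (hf : f ∈ EquivariantFun B ρ.extend) :
    f ∈ EquivariantFun L.bundle ρ.toHom := by
  refine ⟨hf.1, fun u g => ?_⟩
  have hinv : (g.toG0C)⁻¹ = (g⁻¹).toG0C := by
    refine inv_eq_of_mul_eq_one_right (Prod.ext (mul_inv_cancel g.1) ?_)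
    change (QuotientGroup.mk ((1, g.2) * (1, (g⁻¹).2)) : SpinC n) = QuotientGroup.mk 1
    rw [Prod.mk_mul_mk, one_mul, Prod.snd_inv, mul_inv_cancel]
    rfl
  rw [hL.act_eq, hf.2, hinv, ρ.extend_toG0C]

/-- Equivariance for `G₀ᶜ` is equivariance for `G̃₀` and for the central circle, because these two
subgroups generate `G₀ᶜ`. -/
theorem mem_equivariantFun_extend_iff (hL : IsInducedLieContactStructure S B r π α L ξ ξ₀)
    {f : P → V} (hf : f ∈ EquivariantFun L.bundle ρ.toHom) :
    f ∈ EquivariantFun B ρ.extend ↔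
      ∀ u z, f (B.act u (centralCircle n z)) = ((z⁻¹ : Circle) : ℂ) • f u := by
  have hinv : ∀ z : Circle, (centralCircle n z)⁻¹ = centralCircle n z⁻¹ := fun z =>
    inv_eq_of_mul_eq_one_right (by rw [← centralCircle_mul, mul_inv_cancel, centralCircle_one])
  constructor
  · intro h u z
    rw [h.2, hinv, ρ.extend_centralCircle]
  · intro h
    refine ⟨hf.1, fun u g => ?_⟩
    obtain ⟨k, z, rfl⟩ := exists_toG0C_mul_centralCircle g
    have hk : ρ.extend (k.toG0C)⁻¹ (f u) = ρ.toHom k⁻¹ (f u) := by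
      have h1 : ρ.extend k.toG0C (ρ.toHom k⁻¹ (f u)) = f u := by
        rw [ρ.extend_toG0C, ← Module.End.mul_apply, ← map_mul, mul_inv_cancel, map_one,
          Module.End.one_apply]
      rw [← Module.End.one_apply (R := ℂ) (ρ.toHom k⁻¹ (f u)), ← map_one ρ.extend,
        ← inv_mul_cancel k.toG0C, map_mul, Module.End.mul_apply, h1]
    rw [B.act_mul, h, ← hL.act_eq, hf.2, mul_inv_rev, map_mul, Module.End.mul_apply, hk, hinv,
      ρ.extend_centralCircle]

/-- The map `φ` from sections of `P ×_{G₀ᶜ} V → M` to sections of `P ×_{G̃₀} V → N`. In terms of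
equivariant functions on the common total space `P` it is the identity. -/
noncomputable def pullbackSection (hL : IsInducedLieContactStructure S B r π α L ξ ξ₀) :
    AssocSection B ρ.extend →ₗ[ℂ] AssocSection L.bundle ρ.toHom where
  toFun s := AssocSection.ofFun
    ⟨s.frameFun, hL.equivariant_restrict ρ ⟨s.frameFun_smooth, s.frameFun_act⟩⟩
  map_add' s t := AssocSection.frameFun_injective (by
    simp only [AssocSection.frameFun_add, AssocSection.frameFun_ofFun])
  map_smul' c s := AssocSection.frameFun_injective (by
    simp only [AssocSection.frameFun_smul, AssocSection.frameFun_ofFun, RingHom.id_apply])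

theorem frameFun_pullbackSection (hL : IsInducedLieContactStructure S B r π α L ξ ξ₀)
    (s : AssocSection B ρ.extend) : (hL.pullbackSection ρ s).frameFun = s.frameFun :=
  AssocSection.frameFun_ofFun _

theorem pullbackSection_injective (hL : IsInducedLieContactStructure S B r π α L ξ ξ₀) :
    Function.Injective (hL.pullbackSection ρ) := fun s t h =>
  AssocSection.frameFun_injective (by
    rw [← hL.frameFun_pullbackSection ρ s, h, hL.frameFun_pullbackSection])

theorem isCanonicalMap_pullbackSection (hL : IsInducedLieContactStructure S B r π α L ξ ξ₀) :
    IsCanonicalMap (hL.pullbackSection ρ) := by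
  intro s u v h
  rw [AssocSection.toFun_proj] at h ⊢
  rw [hL.frameFun_pullbackSection, Assoc.mk_injective B ρ.extend u h]

theorem mem_range_pullbackSection_iff (hL : IsInducedLieContactStructure S B r π α L ξ ξ₀)
    (v : AssocSection L.bundle ρ.toHom) :
    v ∈ Set.range (hL.pullbackSection ρ) ↔
      ∀ u z, v.frameFun (B.act u (centralCircle n z)) = ((z⁻¹ : Circle) : ℂ) • v.frameFun u := by
  rw [← hL.mem_equivariantFun_extend_iff ρ ⟨v.frameFun_smooth, v.frameFun_act⟩]
  constructor
  · rintro ⟨s, rfl⟩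
    rw [hL.frameFun_pullbackSection]
    exact ⟨s.frameFun_smooth, s.frameFun_act⟩
  · intro h
    exact ⟨AssocSection.ofFun ⟨_, h⟩, AssocSection.frameFun_injective (by
      rw [hL.frameFun_pullbackSection, AssocSection.frameFun_ofFun])⟩

theorem range_pullbackSection [FiniteDimensional ℂ V]
    (hL : IsInducedLieContactStructure S B r π α L ξ ξ₀)
    (hr : IsLift S B r) (hC : IsDeterminantCircleBundle B C π) (hα : IsPrincipalConnection C α) :
    Set.range (hL.pullbackSection ρ) =
      {v | hL.symmetry.lieDerivative v = (-(Complex.I / 2)) • v} := by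
  ext v
  have hlie : (hL.symmetry.lieDerivative v).frameFun = fun u => dirDeriv v.frameFun u (ξ₀ u) :=
    AssocSection.frameFun_ofFun _
  rw [hL.mem_range_pullbackSection_iff, ← hL.dirDeriv_eq_iff hr hC hα v.frameFun_smooth]
  change _ ↔ hL.symmetry.lieDerivative v = (-(Complex.I / 2)) • v
  rw [← AssocSection.frameFun_injective.eq_iff, hlie, AssocSection.frameFun_smul, funext_iff]
  rfl

end Sections

/-! ### Automorphisms of the Lie contact structure and descent of operators -/

/-- The action of an element of the central circle is an automorphism of the Lie contact structure.
It covers the principal action of `z²` on `N`, which preserves `ker α`, and as it covers the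
identity of `𝒢₀` it preserves the partial form pulled back from there. -/
theorem isLieContactMorphism_centralCircle
    (hL : IsInducedLieContactStructure S B r π α L ξ ξ₀)
    (hr : IsLift S B r) (hC : IsDeterminantCircleBundle B C π) (hα : IsPrincipalConnection C α)
    (z : Circle) :
    IsLieContactMorphism L L (fun u => B.act u (centralCircle n z))
      (fun x => C.act x (z ^ 2)) where
  smooth := B.smooth_act_right _
  localDiffeo := by
    let Φ : Diffeomorph (𝓡 (2 * n + 1)) (𝓡 (2 * n + 1)) N N ∞ :=
      { toFun := fun x => C.act x (z ^ 2)
        invFun := fun x => C.act x (z ^ 2)⁻¹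
        left_inv := fun x => by beta_reduce; rw [← C.act_mul, mul_inv_cancel, C.act_one]
        right_inv := fun x => by beta_reduce; rw [← C.act_mul, inv_mul_cancel, C.act_one]
        contMDiff_toFun := C.smooth_act_right _
        contMDiff_invFun := C.smooth_act_right _ }
    exact Φ.isLocalDiffeomorph
  proj_comp u := by rw [hL.proj_eq, hC.act_centralCircle]
  equivariant u g := by
    rw [hL.act_eq, hL.act_eq, ← B.act_mul, ← B.act_mul, G0Tilde.toG0C_mul_centralCircle,
      G0Tilde.centralCircle_mul_toG0C]
  frame u X := by
    set F : P → P := fun u => B.act u (centralCircle n z)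
    set f : N → N := fun x => C.act x (z ^ 2)
    have hF : MDifferentiableAt (𝓡 d) (𝓡 d) F u :=
      (B.smooth_act_right _).mdifferentiable (by simp) u
    have hf : MDifferentiable (𝓡 (2 * n + 1)) (𝓡 (2 * n + 1)) f :=
      (C.smooth_act_right _).mdifferentiable (by simp)
    have hp : MDifferentiable (𝓡 d) (𝓡 (2 * n + 1)) L.bundle.proj :=
      L.bundle.smooth_proj.mdifferentiable (by simp)
    have hpF : L.bundle.proj ∘ F = f ∘ L.bundle.proj := funext fun u => by
      simp only [Function.comp_apply, hL.proj_eq, F, f, hC.act_centralCircle]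
    have hpFu : L.bundle.proj (F u) = f (L.bundle.proj u) := congrFun hpF u
    have hrF : r ∘ F = r := funext fun u => hr.act_centralCircle u z
    have hrFu : r (F u) = r u := congrFun hrF u
    obtain ⟨v, hv⟩ := L.bundle.surjective_mfderiv_proj u (L.frame u X)
    -- the image of `v` under the tangent map of `F` projects to the image of the frame vector
    have hproj : mfderiv (𝓡 d) (𝓡 (2 * n + 1)) L.bundle.proj (F u) (mfderiv (𝓡 d) (𝓡 d) F u v) =
        mfderiv (𝓡 (2 * n + 1)) (𝓡 (2 * n + 1)) f (L.bundle.proj u) (L.frame u X) := by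
      have h1 := mfderiv_comp u (hp (F u)) hF
      rw [hpF, mfderiv_comp u (hf _) (hp u)] at h1
      have h2 := congrArg (fun T => T v) h1
      rw [← hv]
      exact h2.symm
    have hr' : mfderiv (𝓡 d) (𝓡 e) r (F u) (mfderiv (𝓡 d) (𝓡 d) F u v) =
        mfderiv (𝓡 d) (𝓡 e) r u v := by
      have h1 := mfderiv_comp u (hr.smooth.mdifferentiable (by simp) (F u)) hF
      rw [hrF] at h1
      exact (congrArg (fun T => T v) h1).symm
    -- it lies in the contact distribution, hence is a frame vector `L.frame (F u) X'`
    have hker : ∀ y, y = f (L.bundle.proj u) →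
        (mfderiv (𝓡 (2 * n + 1)) (𝓡 (2 * n + 1)) f (L.bundle.proj u) (L.frame u X) :
          EuclideanSpace ℝ (Fin (2 * n + 1))) ∈ L.H y := by
      rintro y rfl
      have hX : L.frame u X ∈ L.H (L.bundle.proj u) := L.range_frame u ▸ ⟨X, rfl⟩
      rw [hL.contact] at hX ⊢
      exact (hα.invariant _ (z ^ 2) _).trans hX
    have hmem := hker _ hpFu
    rw [← L.range_frame] at hmem
    obtain ⟨X', hX'⟩ := hmem
    have hs := hL.quotient.soldering u v X hv
    have hs' := hL.quotient.soldering (F u) (mfderiv (𝓡 d) (𝓡 d) F u v) X' (hproj.trans hX'.symm)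
    -- `F u` and `u` have the same image in `𝒢₀`, and there `X` and `X'` give the same tangent vector
    have hXX : X' = X := by
      have key : ∀ w, w = r u →
          ∀ a : EuclideanSpace ℝ (Fin e), a = mfderiv (𝓡 d) (𝓡 e) r u v →
          mfderiv (𝓡 e) (𝓡 (2 * n)) S.bundle.proj w a = S.frame w X' → X' = X := by
        rintro w rfl a rfl h
        exact (S.frame (r u)).injective (h.symm.trans hs)
      exact key _ hrFu _ hr' hs'
    subst hXX
    refine Bundle.TotalSpace.ext hpFu.symm ?_
    exact heq_of_eq hX'.symm

/-- A natural operator commutes with the action of the central circle, so it maps the range of `φ`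
for the first representation to the range of `φ` for the second. -/
theorem natural_mem_range_pullbackSection {P N : Type u}
    [TopologicalSpace P] [ChartedSpace (EuclideanSpace ℝ (Fin d)) P]
    [IsManifold (𝓡 d) ∞ P] [T2Space P] [SecondCountableTopology P]
    [TopologicalSpace N] [ChartedSpace (EuclideanSpace ℝ (Fin (2 * n + 1))) N]
    [IsManifold (𝓡 (2 * n + 1)) ∞ N] [T2Space N] [SecondCountableTopology N]
    {B : PrincipalBundle (G0C n) d (2 * n) P M} {r : P → Q}
    {C : PrincipalBundle Circle (2 * n + 1) (2 * n) N M} {π : P → N}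
    {α : ∀ x : N, TangentSpace (𝓡 (2 * n + 1)) x →ₗ[ℝ] ℝ}
    {L : LieContactStructure n d P N} {ξ : ∀ x : N, TangentSpace (𝓡 (2 * n + 1)) x}
    {ξ₀ : ∀ u : P, TangentSpace (𝓡 d) u}
    (hL : IsInducedLieContactStructure S B r π α L ξ ξ₀)
    (hr : IsLift S B r) (hC : IsDeterminantCircleBundle B C π) (hα : IsPrincipalConnection C α)
    {V W : Type*} [NormedAddCommGroup V] [NormedSpace ℂ V]
    [NormedAddCommGroup W] [NormedSpace ℂ W] {ρ : SpinorRep n V} {ϑ : SpinorRep n W}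
    (𝒟 : NaturalOperator.{u} n ρ ϑ) (s : AssocSection B ρ.extend) :
    𝒟.op L (hL.pullbackSection ρ s) ∈ Set.range (hL.pullbackSection ϑ) := by
  rw [hL.mem_range_pullbackSection_iff]
  intro u z
  have hs := (hL.mem_range_pullbackSection_iff ρ (hL.pullbackSection ρ s)).1 ⟨s, rfl⟩
  -- the pullback of `φ(s)` by the automorphism is `z⁻¹ φ(s)`
  have h := 𝒟.natural L L _ _ (hL.isLieContactMorphism_centralCircle hr hC hα z)
    (((z⁻¹ : Circle) : ℂ) • hL.pullbackSection ρ s) (hL.pullbackSection ρ s)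
    (fun u => by rw [AssocSection.frameFun_smul, hs]; rfl) u
  rw [map_smul, AssocSection.frameFun_smul] at h
  exact h.symm

end IsInducedLieContactStructure

end LieContact

/-! ### The isomorphism and the descended operator -/

theorem mainTheorem4 {n e d : ℕ} (hn : 3 ≤ n)
    -- the base manifold of dimension `2n`
    {M : Type u} [TopologicalSpace M] [ChartedSpace (EuclideanSpace ℝ (Fin (2 * n))) M]
    [IsManifold (𝓡 (2 * n)) ∞ M] [T2Space M] [SecondCountableTopology M]
    -- the PCS-structure of Grassmannian type on it
    {Q : Type u} [TopologicalSpace Q] [ChartedSpace (EuclideanSpace ℝ (Fin e)) Q]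
    [IsManifold (𝓡 e) ∞ Q] [T2Space Q] [SecondCountableTopology Q]
    (S : G0Structure n e Q M) (hS : IsPCS S)
    -- the lift to a principal bundle with structure group `G₀ᶜ`
    {P : Type u} [TopologicalSpace P] [ChartedSpace (EuclideanSpace ℝ (Fin d)) P]
    [IsManifold (𝓡 d) ∞ P] [T2Space P] [SecondCountableTopology P]
    (B : PrincipalBundle (G0C n) d (2 * n) P M) (r : P → Q) (hr : IsLift S B r)
    -- its determinant circle bundle with a compatible principal connection
    {N : Type u} [TopologicalSpace N] [ChartedSpace (EuclideanSpace ℝ (Fin (2 * n + 1))) N]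
    [IsManifold (𝓡 (2 * n + 1)) ∞ N] [T2Space N] [SecondCountableTopology N]
    (C : PrincipalBundle Circle (2 * n + 1) (2 * n) N M) (π : P → N)
    (hC : IsDeterminantCircleBundle B C π)
    (α : ∀ x : N, TangentSpace (𝓡 (2 * n + 1)) x →ₗ[ℝ] ℝ) (hα : IsCompatibleConnection S C α)
    -- the Lie contact structure on the circle bundle with its infinitesimal symmetry
    (L : LieContactStructure n d P N) (ξ : ∀ x : N, TangentSpace (𝓡 (2 * n + 1)) x)
    (ξ₀ : ∀ u : P, TangentSpace (𝓡 d) u)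
    (hL : IsInducedLieContactStructure S B r π α L ξ ξ₀)
    -- the representations
    {V : Type*} [NormedAddCommGroup V] [NormedSpace ℂ V] [FiniteDimensional ℂ V]
    {W : Type*} [NormedAddCommGroup W] [NormedSpace ℂ W] [FiniteDimensional ℂ W]
    (ρ : SpinorRep n V) (ϑ : SpinorRep n W) :
    ∃ (φV : AssocSection B ρ.extend →ₗ[ℂ] AssocSection L.bundle ρ.toHom)
      (φW : AssocSection B ϑ.extend →ₗ[ℂ] AssocSection L.bundle ϑ.toHom),
      (IsCanonicalMap φV ∧ Function.Injective φV ∧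
        Set.range φV = {v | hL.symmetry.lieDerivative v = (-(Complex.I / 2)) • v}) ∧
      (IsCanonicalMap φW ∧ Function.Injective φW ∧
        Set.range φW = {w | hL.symmetry.lieDerivative w = (-(Complex.I / 2)) • w}) ∧
      ∀ 𝒟 : NaturalOperator.{u} n ρ ϑ,
        ∃! D : AssocSection B ρ.extend →ₗ[ℂ] AssocSection B ϑ.extend,
          IsDifferentialOperator D ∧ ∀ s, φW (D s) = 𝒟.op L (φV s) := by
  have hconn := hα.isPrincipalConnection
  refine ⟨hL.pullbackSection ρ, hL.pullbackSection ϑ,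
    ⟨hL.isCanonicalMap_pullbackSection ρ, hL.pullbackSection_injective ρ,
      hL.range_pullbackSection ρ hr hC hconn⟩,
    ⟨hL.isCanonicalMap_pullbackSection ϑ, hL.pullbackSection_injective ϑ,
      hL.range_pullbackSection ϑ hr hC hconn⟩, fun 𝒟 => ?_⟩
  let Φ := LinearEquiv.ofInjective (hL.pullbackSection ϑ) (hL.pullbackSection_injective ϑ)
  let D : AssocSection B ρ.extend →ₗ[ℂ] AssocSection B ϑ.extend := Φ.symm.toLinearMap ∘ₗ
    ((𝒟.op L ∘ₗ hL.pullbackSection ρ).codRestrict (LinearMap.range (hL.pullbackSection ϑ))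
      (hL.natural_mem_range_pullbackSection hr hC hconn 𝒟))
  have hD : ∀ s, hL.pullbackSection ϑ (D s) = 𝒟.op L (hL.pullbackSection ρ s) := fun s =>
    congrArg Subtype.val (Φ.apply_symm_apply _)
  refine ⟨D, ⟨?_, hD⟩, fun D' hD' => LinearMap.ext fun s =>
    hL.pullbackSection_injective ϑ ((hD'.2 s).trans (hD s).symm)⟩
  obtain ⟨k, hk⟩ := 𝒟.isDifferentialOperator L
  refine ⟨k, fun s x hs => ?_⟩
  obtain ⟨u, rfl⟩ := B.surjective_proj x
  rw [AssocSection.toFun_proj_eq_zero_iff, ← hL.frameFun_pullbackSection, hD,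
    ← AssocSection.toFun_proj_eq_zero_iff]
  refine hk _ _ fun v hv => ?_
  rw [hL.frameFun_pullbackSection]
  -- points of `P` over the same point of `N` lie over the same point of `M`
  refine hs v ?_
  rw [hL.proj_eq] at hv
  rw [← hC.proj_comp, ← hC.proj_comp, hv]
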